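/- Let $G\in C^1(\mathbb{R})$ and $g=G'$, with $G(0)=g(0)=0$ and $g$ non-decreasing and Lipschitz on $[0,\infty)$, and let $\theta>0$. Let $(u,w)$ be a classical solution of $$(-\Delta)^{1/2}u+u=\theta\,w\,g(u),\qquad (-\Delta)^{1/2}w=\pi\,G(u)\qquad\text{in }\mathbb{R},$$ that is, $u,w\in C^{1,1}_{\mathrm{loc}}(\mathbb{R})$ with $\int_{\mathbb{R}}\frac{|u(x)|+|w(x)|}{1+|x|^2}\,dx<\infty$, and both equations hold at every point of $\mathbb{R}$, where $$(-\Delta)^{1/2}\varphi(x)=\frac1\pi\,\mathrm{P.V.}\!\int_{\mathbb{R}}\frac{\varphi(x)-\varphi(y)}{|x-y|^2}\,dy .$$ Suppose that $u>0$ in $\mathbb{R}$, $u\in L^\infty(\mathbb{R})$, and $w(x)\to-\infty$ as $|x|\to\infty$. Then, up to a translation, $u$ is even and radially decreasing: there is $x_0\in\mathbb{R}$ such that $u(x_0+x)=u(x_0-x)$ for all $x\in\mathbb{R}$ and $r\mapsto u(x_0+r)$ is strictly decreasing on $[0,\infty)$. -/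

import Mathlib

/-- `φ ∈ C^{1,1}_loc(ℝ)`: `φ` is continuously differentiable and `φ'` is locally Lipschitz. -/
def IsC11Loc (φ : ℝ → ℝ) : Prop :=
  ContDiff ℝ 1 φ ∧ LocallyLipschitz (deriv φ)

/-- The weighted space `L_{1/2}(ℝ)`: locally integrable functions with
`∫ |φ(x)| / (1 + |x|²) dx < ∞`. -/
def MemLHalf (φ : ℝ → ℝ) : Prop :=
  MeasureTheory.LocallyIntegrable φ ∧
    MeasureTheory.Integrable (fun x : ℝ => |φ x| / (1 + |x| ^ 2))

/-- `(-Δ)^{1/2} φ (x) = L` pointwise: the principal value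
`(1/π) P.V. ∫ (φ(x) - φ(y)) / |x - y|² dy` exists and equals `L`. The normalization constant
of the half-Laplacian on the line is `1/π`. For `φ ∈ L_{1/2}(ℝ)` the truncated integrals
converge absolutely. -/
def HasHalfLaplacianAt (φ : ℝ → ℝ) (L x : ℝ) : Prop :=
  Filter.Tendsto
    (fun ε : ℝ => (1 / Real.pi) * ∫ y in {y : ℝ | ε < |x - y|}, (φ x - φ y) / |x - y| ^ 2)
    (nhdsWithin 0 (Set.Ioi 0)) (nhds L)

/-- `(u, w)` is a classical solution on `ℝ` of the system
`(-Δ)^{1/2} u + u = θ w G'(u)`, `(-Δ)^{1/2} w = π G(u)`. -/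
structure IsClassicalSolution (G : ℝ → ℝ) (θ : ℝ) (u w : ℝ → ℝ) : Prop where
  u_c11 : IsC11Loc u
  u_mem : MemLHalf u
  w_c11 : IsC11Loc w
  w_mem : MemLHalf w
  eq_u : ∀ x : ℝ, ∃ L : ℝ, HasHalfLaplacianAt u L x ∧ L + u x = θ * w x * deriv G (u x)
  eq_w : ∀ x : ℝ, HasHalfLaplacianAt w (Real.pi * G (u x)) x

open MeasureTheory Set Filter Topology

/-! The proof moves a reflection point `c` in from the right and studies the odd functions U(s) =
u(c-s) - u(c+s) and W(s) = w(c-s) - w(c+s) on s > 0.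

Three a priori facts make this possible. Since w ≤ 0 far out, u is a subsolution of (-Δ)^{1/2}u + u
≤ 0 there, and a barrier gives u = O(1/(1+x²)) (`exists_quadratic_decay`). Since G(u) ≥ 0, w is
half-superharmonic, hence at least -o(|x|) (`exists_neg_mul_abs_le_of_superharmonic`), so W + κs
attains a negative minimum for every κ > 0. Finally, at a minimum a over (0,∞) of an odd function V,
perhaps after adding κs, π(-Δ)^{1/2}V(a) ≤ 2(V(a)+κa)/a, and the inequality is strict in the
zero-minimum, non-trivial case (`le_of_odd_of_min`, `neg_of_odd`).

The system is decoupled by `exists_reflected_w_ge`: U ≥ -N forces W ≥ -CN, with C uniform for c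
bounded below; the decay of u absorbs the factor a coming from the maximum principle. Inserted in
the equation for U at a negative minimum, this confines the minimum point to s ≥ δ and c+s ≤ R
(`exists_reflected_neg_near`). So U ≥ 0 for large c, and at the critical c₀ either U vanishes
somewhere, hence identically, or compactness lets the reflection point move further left. A second
symmetry point c > c₀ would make u periodic, contradicting u → 0 and u > 0. -/

/-! ### Truncated integrals, second differences and reflections -/

/-- Absolute convergence of the truncated integrals defining the half-Laplacian at `x`. -/
def TailIntegrableAt (φ : ℝ → ℝ) (x : ℝ) : Prop :=
  ∀ ε : ℝ, 0 < ε → IntegrableOn (fun y => (φ x - φ y) / |x - y| ^ 2) {y : ℝ | ε < |x - y|}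

theorem measurableSet_lt_abs_sub (x ε : ℝ) : MeasurableSet {y : ℝ | ε < |x - y|} :=
  (isOpen_lt continuous_const (by fun_prop)).measurableSet

theorem MemLHalf.tailIntegrableAt {φ : ℝ → ℝ} (h : MemLHalf φ) (x : ℝ) :
    TailIntegrableAt φ x := by
  intro ε hε
  -- From y² ≤ 2x² + 2(x-y)² and |x-y| > ε: this `C` gives 1 + y² ≤ C|x-y|².
  set C : ℝ := (1 + 2 * x ^ 2) / ε ^ 2 + 2 with hC
  have hmaj : Integrable (fun y : ℝ => C * (|φ x| * (1 + y ^ 2)⁻¹ + |φ y| / (1 + |y| ^ 2))) :=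
    ((integrable_inv_one_add_sq.const_mul _).add h.2).const_mul _
  refine Integrable.mono' hmaj.integrableOn ?_ ?_
  · have h1 : AEStronglyMeasurable φ volume := h.1.aestronglyMeasurable
    have h2 : AEMeasurable (fun y => (φ x - φ y) / |x - y| ^ 2) volume := by
      refine (aemeasurable_const.sub h1.aemeasurable).div ?_
      exact (Continuous.measurable (by fun_prop)).aemeasurable
    exact h2.aestronglyMeasurable.restrict
  · refine (ae_restrict_iff' (measurableSet_lt_abs_sub x ε)).2 (Eventually.of_forall ?_)
    intro y hy
    have hy' : ε < |x - y| := hy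
    have hd : 0 < |x - y| := hε.trans hy'
    have hsq : |x - y| ^ 2 = (x - y) ^ 2 := sq_abs _
    have hεsq : ε ^ 2 ≤ |x - y| ^ 2 := by gcongr
    have hle : 1 + y ^ 2 ≤ C * |x - y| ^ 2 := by
      have h3 : 1 + 2 * x ^ 2 ≤ (1 + 2 * x ^ 2) / ε ^ 2 * |x - y| ^ 2 := by
        rw [div_mul_eq_mul_div, le_div_iff₀ (by positivity)]
        gcongr
      rw [hC, add_mul, hsq] at *
      nlinarith [sq_nonneg (2 * x - y)]
    rw [Real.norm_eq_abs, abs_div, abs_of_pos (pow_pos hd 2), div_le_iff₀ (pow_pos hd 2), sq_abs y]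
    have hA : |φ x - φ y| ≤ |φ x| + |φ y| := by
      simpa using abs_sub (φ x) (φ y)
    have hpos : 0 < 1 + y ^ 2 := by positivity
    calc |φ x - φ y| ≤ (|φ x| + |φ y|) / (1 + y ^ 2) * (1 + y ^ 2) := by
          rw [div_mul_cancel₀ _ hpos.ne']; exact hA
      _ ≤ (|φ x| + |φ y|) / (1 + y ^ 2) * (C * |x - y| ^ 2) := by gcongr
      _ = _ := by field_simp

/-- Pairing y = x+z with y = x-z removes the principal value. A one-sided pointwise bound on the
second difference by an integrable function then survives ε → 0, with no regularity of φ at x; this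
is how test functions are used below. -/
theorem tailIntegral_eq_secondDifference {φ : ℝ → ℝ} {x : ℝ} (h : TailIntegrableAt φ x) {ε : ℝ}
    (hε : 0 < ε) :
    IntegrableOn (fun z => (2 * φ x - φ (x + z) - φ (x - z)) / z ^ 2) (Ioi ε) ∧
    ∫ y in {y : ℝ | ε < |x - y|}, (φ x - φ y) / |x - y| ^ 2 =
      ∫ z in Ioi ε, (2 * φ x - φ (x + z) - φ (x - z)) / z ^ 2 := by
  have hset : {y : ℝ | ε < |x - y|} = Ioi (x + ε) ∪ Iio (x - ε) := by
    ext y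
    simp only [mem_ofPred_eq, mem_union, mem_Ioi, mem_Iio, lt_abs]
    constructor
    · rintro (h | h)
      · right; linarith
      · left; linarith
    · rintro (h | h)
      · right; linarith
      · left; linarith
  have hpre1 : (fun z => x + z) ⁻¹' Ioi (x + ε) = Ioi ε := by ext; simp
  have hpre2 : (fun z => x - z) ⁻¹' Iio (x - ε) = Ioi ε := by ext; simp
  have mp1 : MeasurePreserving (fun z : ℝ => x + z) volume volume :=
    measurePreserving_add_left volume x
  have mp2 : MeasurePreserving (fun z : ℝ => x - z) volume volume :=
    Measure.measurePreserving_sub_left volume x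
  have e1 : MeasurableEmbedding (fun z : ℝ => x + z) := (MeasurableEquiv.addLeft x).measurableEmbedding
  have e2 : MeasurableEmbedding (fun z : ℝ => x - z) := (MeasurableEquiv.subLeft x).measurableEmbedding
  have hi := h ε hε
  rw [hset] at hi ⊢
  have i1 := (mp1.integrableOn_comp_preimage e1).2 (hi.mono_set subset_union_left)
  have i2 := (mp2.integrableOn_comp_preimage e2).2 (hi.mono_set subset_union_right)
  have s1 := mp1.setIntegral_preimage_emb e1 (fun y => (φ x - φ y) / |x - y| ^ 2) (Ioi (x + ε))
  have s2 := mp2.setIntegral_preimage_emb e2 (fun y => (φ x - φ y) / |x - y| ^ 2) (Iio (x - ε))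
  rw [hpre1] at i1 s1
  rw [hpre2] at i2 s2
  have hEq : ∀ z : ℝ, (2 * φ x - φ (x + z) - φ (x - z)) / z ^ 2 =
      (φ x - φ (x + z)) / |x - (x + z)| ^ 2 + (φ x - φ (x - z)) / |x - (x - z)| ^ 2 := by
    intro z
    rw [sq_abs, sq_abs]
    ring_nf
  simp only [hEq]
  simp only [Function.comp_def] at i1 i2
  refine ⟨i1.add i2, ?_⟩
  rw [setIntegral_union _ measurableSet_Iio (hi.mono_set subset_union_left)
    (hi.mono_set subset_union_right), integral_add i1 i2, s1, s2]
  refine Set.disjoint_left.2 fun y hy hy' => ?_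
  simp only [mem_Ioi, mem_Iio] at hy hy'
  linarith

theorem tendsto_setIntegral_Ioi_zero {h : ℝ → ℝ} (hh : IntegrableOn h (Ioi 0)) :
    Tendsto (fun ε : ℝ => ∫ z in Ioi ε, h z) (𝓝[>] 0) (𝓝 (∫ z in Ioi 0, h z)) := by
  have hid : Tendsto (fun ε : ℝ => ε) (𝓝[>] (0 : ℝ)) (𝓝 0) := tendsto_id.mono_left nhdsWithin_le_nhds
  have := (aecover_Ioi_of_Ioi (μ := volume) hid).integral_tendsto_of_countably_generated hh
  refine this.congr' ?_
  filter_upwards [self_mem_nhdsWithin] with ε hε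
  have hε' : (0 : ℝ) < ε := hε
  rw [Measure.restrict_restrict measurableSet_Ioi, Ioi_inter_Ioi, max_eq_left hε'.le]

theorem HasHalfLaplacianAt.tendsto_tailIntegral {φ : ℝ → ℝ} {L x : ℝ}
    (h : HasHalfLaplacianAt φ L x) :
    Tendsto (fun ε : ℝ => ∫ y in {y : ℝ | ε < |x - y|}, (φ x - φ y) / |x - y| ^ 2) (𝓝[>] 0)
      (𝓝 (Real.pi * L)) := by
  refine (h.const_mul Real.pi).congr fun ε => ?_
  field_simp

theorem HasHalfLaplacianAt.le_of_secondDifference_le {φ h : ℝ → ℝ} {L x : ℝ}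
    (hL : HasHalfLaplacianAt φ L x) (ht : TailIntegrableAt φ x) (hh : IntegrableOn h (Ioi 0))
    (hle : ∀ z : ℝ, 0 < z → (2 * φ x - φ (x + z) - φ (x - z)) / z ^ 2 ≤ h z) :
    Real.pi * L ≤ ∫ z in Ioi 0, h z := by
  refine le_of_tendsto_of_tendsto hL.tendsto_tailIntegral (tendsto_setIntegral_Ioi_zero hh) ?_
  filter_upwards [self_mem_nhdsWithin] with ε hε
  obtain ⟨h1, h2⟩ := tailIntegral_eq_secondDifference ht hε
  rw [h2]
  exact setIntegral_mono_on h1 (hh.mono_set (Ioi_subset_Ioi (le_of_lt hε))) measurableSet_Ioi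
    fun z hz => hle z (lt_trans hε hz)

theorem HasHalfLaplacianAt.ge_of_le_secondDifference {φ h : ℝ → ℝ} {L x : ℝ}
    (hL : HasHalfLaplacianAt φ L x) (ht : TailIntegrableAt φ x) (hh : IntegrableOn h (Ioi 0))
    (hle : ∀ z : ℝ, 0 < z → h z ≤ (2 * φ x - φ (x + z) - φ (x - z)) / z ^ 2) :
    ∫ z in Ioi 0, h z ≤ Real.pi * L := by
  refine le_of_tendsto_of_tendsto (tendsto_setIntegral_Ioi_zero hh) hL.tendsto_tailIntegral ?_
  filter_upwards [self_mem_nhdsWithin] with ε hε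
  obtain ⟨h1, h2⟩ := tailIntegral_eq_secondDifference ht hε
  rw [h2]
  exact setIntegral_mono_on (hh.mono_set (Ioi_subset_Ioi (le_of_lt hε))) h1 measurableSet_Ioi
    fun z hz => hle z (lt_trans hε hz)

/-- The half-Laplacian of the odd part of `φ` about `c`. -/
theorem HasHalfLaplacianAt.reflection_sub {φ : ℝ → ℝ} {L₁ L₂ c a : ℝ}
    (h₁ : HasHalfLaplacianAt φ L₁ (c + a)) (h₂ : HasHalfLaplacianAt φ L₂ (c - a))
    (t₁ : TailIntegrableAt φ (c + a)) (t₂ : TailIntegrableAt φ (c - a)) :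
    HasHalfLaplacianAt (fun s => φ (c - s) - φ (c + s)) (L₂ - L₁) a ∧
      TailIntegrableAt (fun s => φ (c - s) - φ (c + s)) a := by
  have mp1 : MeasurePreserving (fun z : ℝ => c + z) volume volume :=
    measurePreserving_add_left volume c
  have mp2 : MeasurePreserving (fun z : ℝ => c - z) volume volume :=
    Measure.measurePreserving_sub_left volume c
  have e1 : MeasurableEmbedding (fun z : ℝ => c + z) := (MeasurableEquiv.addLeft c).measurableEmbedding
  have e2 : MeasurableEmbedding (fun z : ℝ => c - z) := (MeasurableEquiv.subLeft c).measurableEmbedding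
  have hpre1 : ∀ ε, (fun z => c + z) ⁻¹' {y : ℝ | ε < |c + a - y|} = {y : ℝ | ε < |a - y|} := by
    intro ε; ext y; simp
  have hpre2 : ∀ ε, (fun z => c - z) ⁻¹' {y : ℝ | ε < |c - a - y|} = {y : ℝ | ε < |a - y|} := by
    intro ε; ext y
    simp only [mem_preimage, mem_ofPred_eq]
    rw [show c - a - (c - y) = -(a - y) by ring, abs_neg]
  have i1 : ∀ ε, 0 < ε → IntegrableOn (fun y => (φ (c + a) - φ (c + y)) / |a - y| ^ 2)
      {y : ℝ | ε < |a - y|} := by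
    intro ε hε
    have := (mp1.integrableOn_comp_preimage e1).2 (t₁ ε hε)
    rw [hpre1] at this
    refine this.congr_fun (fun y _ => ?_) (measurableSet_lt_abs_sub a ε)
    simp
  have i2 : ∀ ε, 0 < ε → IntegrableOn (fun y => (φ (c - a) - φ (c - y)) / |a - y| ^ 2)
      {y : ℝ | ε < |a - y|} := by
    intro ε hε
    have := (mp2.integrableOn_comp_preimage e2).2 (t₂ ε hε)
    rw [hpre2] at this
    refine this.congr_fun (fun y _ => ?_) (measurableSet_lt_abs_sub a ε)
    simp only [Function.comp]
    rw [show c - a - (c - y) = -(a - y) by ring, abs_neg]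
  have hEq : ∀ y, (φ (c - a) - φ (c + a) - (φ (c - y) - φ (c + y))) / |a - y| ^ 2 =
      (φ (c - a) - φ (c - y)) / |a - y| ^ 2 - (φ (c + a) - φ (c + y)) / |a - y| ^ 2 := by
    intro y; ring
  constructor
  · unfold HasHalfLaplacianAt at *
    refine (h₂.sub h₁).congr' ?_
    filter_upwards [self_mem_nhdsWithin] with ε hε
    simp only [hEq]
    rw [integral_sub (i2 ε hε) (i1 ε hε), mul_sub]
    congr 2
    · rw [← mp2.setIntegral_preimage_emb e2, hpre2]
      refine setIntegral_congr_fun (measurableSet_lt_abs_sub a ε) fun y _ => ?_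
      rw [show c - a - (c - y) = -(a - y) by ring, abs_neg]
    · rw [← mp1.setIntegral_preimage_emb e1, hpre1]
      refine setIntegral_congr_fun (measurableSet_lt_abs_sub a ε) fun y _ => ?_
      simp
  · intro ε hε
    simp only [hEq]
    exact (i2 ε hε).sub (i1 ε hε)

/-! ### Maximum principles for odd functions on the half-line -/

theorem intervalIntegral_inv_add_sq {a Z : ℝ} (ha : 0 < a) (haZ : a ≤ Z) :
    ∫ s in (0 : ℝ)..(Z - a), 1 / (a + s) ^ 2 = 1 / a - 1 / Z := by
  have hne : ∀ s ∈ uIcc 0 (Z - a), a + s ≠ 0 := by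
    intro s hs
    rw [uIcc_of_le (by linarith)] at hs
    linarith [hs.1]
  have hd : ∀ s ∈ uIcc 0 (Z - a), HasDerivAt (fun s => -(a + s)⁻¹) (1 / (a + s) ^ 2) s := by
    intro s hs
    have h1 : HasDerivAt (fun s => a + s) 1 s := (hasDerivAt_id s).const_add a
    refine ((h1.inv (hne s hs)).neg).congr_deriv ?_
    ring
  rw [intervalIntegral.integral_eq_sub_of_hasDerivAt hd]
  · simp [sub_eq_add_neg, add_comm]
  · refine ContinuousOn.intervalIntegrable ?_
    exact continuousOn_const.div (by fun_prop) fun s hs => pow_ne_zero 2 (hne s hs)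

theorem isOpen_annulus (a ε Z : ℝ) : IsOpen {y : ℝ | ε < |a - y| ∧ |a - y| < Z} :=
  isOpen_Ioo.preimage (by fun_prop : Continuous fun y : ℝ => |a - y|)

theorem isCompact_annulus (a ε Z : ℝ) : IsCompact {y : ℝ | ε ≤ |a - y| ∧ |a - y| ≤ Z} := by
  refine isCompact_Icc.of_isClosed_subset (s := Icc (a - Z) (a + Z))
    (isClosed_Icc.preimage (by fun_prop : Continuous fun y : ℝ => |a - y|)) ?_
  rintro y ⟨-, hy⟩
  rw [abs_le] at hy
  constructor <;> linarith [hy.1, hy.2]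

/-- Folding y < 0 onto s = -y > 0, oddness gives V(a) - V(y) = 2V(a) + (V(s) - V(a)). The constant
integrates to 2V(a)(1/a - 1/Z); the rest joins the part y > 0 with kernel 1/(a-s)² - 1/(a+s)² > 0,
so minimality gives it a sign. The part over `E` is retained for the strong maximum principle. -/
theorem annulusIntegral_le_of_odd {V : ℝ → ℝ} (hV : Continuous V) (hodd : ∀ s, V (-s) = -V s)
    {a ε Z : ℝ} (hε : 0 < ε) (hεa : ε < a) (haZ : a < Z) (hmin : ∀ s, 0 < s → V a ≤ V s)
    {E : Set ℝ} (hE : E ⊆ {y : ℝ | ε < |a - y| ∧ |a - y| < Z} ∩ Ioi 0) :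
    ∫ y in {y : ℝ | ε < |a - y| ∧ |a - y| < Z}, (V a - V y) / |a - y| ^ 2 ≤
      2 * V a * (1 / a - 1 / Z) + (∫ s in Icc (a - ε) (a + ε), (V s - V a) / (a + s) ^ 2) -
        ∫ s in E, (V s - V a) * (1 / (a - s) ^ 2 - 1 / (a + s) ^ 2) := by
  have ha : 0 < a := hε.trans hεa
  set A : Set ℝ := {y : ℝ | ε < |a - y| ∧ |a - y| < Z} with hA
  have hAo : IsOpen A := isOpen_annulus a ε Z
  set K : Set ℝ := {y : ℝ | ε ≤ |a - y| ∧ |a - y| ≤ Z} with hK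
  have hKc : IsCompact K := isCompact_annulus a ε Z
  have hAK : A ⊆ K := fun y hy => ⟨hy.1.le, hy.2.le⟩
  have hKne : ∀ y ∈ K, a - y ≠ 0 := fun y hy h => by
    have := hy.1
    rw [h, abs_zero] at this
    linarith
  set f : ℝ → ℝ := fun y => (V a - V y) / |a - y| ^ 2 with hf
  have hfA : IntegrableOn f A := by
    refine (ContinuousOn.integrableOn_compact hKc ?_).mono_set hAK
    exact ContinuousOn.div (by fun_prop) (by fun_prop)
      fun y hy => pow_ne_zero 2 (abs_ne_zero.2 (hKne y hy))
  set q : ℝ → ℝ := fun s => (V s - V a) / (a + s) ^ 2 with hq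
  have hqI : ∀ S : Set ℝ, S ⊆ Icc 0 (a + Z) → IntegrableOn q S := by
    intro S hS
    refine (ContinuousOn.integrableOn_compact (isCompact_Icc (a := 0) (b := a + Z)) ?_).mono_set hS
    refine ContinuousOn.div (by fun_prop) (by fun_prop) fun y hy => pow_ne_zero 2 ?_
    linarith [hy.1]
  have hq0 : ∀ s, 0 < s → 0 ≤ q s := fun s hs =>
    div_nonneg (sub_nonneg.2 (hmin s hs)) (sq_nonneg _)
  have hsplit : ∫ y in A, f y = (∫ y in A ∩ Ioi 0, f y) + ∫ y in A ∩ Iic 0, f y := by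
    rw [← setIntegral_union _ (hAo.measurableSet.inter measurableSet_Iic)
      (hfA.mono_set inter_subset_left) (hfA.mono_set inter_subset_left), ← inter_union_distrib_left]
    · congr 2
      ext y; simp
    · refine Set.disjoint_left.2 fun y hy hy' => ?_
      exact absurd (mem_Ioi.1 hy.2) (not_lt.2 hy'.2)
  have hneg : A ∩ Iic 0 = Ioc (a - Z) 0 := by
    ext y
    simp only [hA, mem_inter_iff, mem_ofPred_eq, mem_Iic, mem_Ioc]
    constructor
    · rintro ⟨⟨-, h2⟩, h3⟩
      rw [abs_lt] at h2
      exact ⟨by linarith, h3⟩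
    · rintro ⟨h1, h2⟩
      rw [abs_of_pos (by linarith)]
      exact ⟨⟨by linarith, by linarith⟩, h2⟩
  have hminus : ∫ y in A ∩ Iic 0, f y = 2 * V a * (1 / a - 1 / Z) + ∫ s in Ioc 0 (Z - a), q s := by
    rw [hneg, ← intervalIntegral.integral_of_le (by linarith),
      ← intervalIntegral.integral_of_le (by linarith), ← intervalIntegral_inv_add_sq ha haZ.le,
      ← intervalIntegral.integral_const_mul, ← intervalIntegral.integral_add]
    · have := intervalIntegral.integral_comp_neg (a := 0) (b := Z - a) f
      rw [neg_zero, neg_sub] at this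
      rw [← this]
      refine intervalIntegral.integral_congr fun s hs => ?_
      rw [uIcc_of_le (by linarith)] at hs
      have : 0 < a + s := by linarith [hs.1]
      simp only [hf, hq, hodd, sub_neg_eq_add, abs_of_pos this]
      field_simp
      ring
    · refine ContinuousOn.intervalIntegrable ?_
      rw [uIcc_of_le (by linarith)]
      refine continuousOn_const.mul (continuousOn_const.div (by fun_prop) fun s hs => ?_)
      exact pow_ne_zero 2 (by linarith [hs.1])
    · rw [intervalIntegrable_iff_integrableOn_Ioc_of_le (by linarith)]
      exact hqI _ fun s hs => ⟨hs.1.le, by linarith [hs.2]⟩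
  have hApos : A ∩ Ioi 0 ⊆ Icc 0 (a + Z) := by
    rintro s ⟨⟨-, h2⟩, h3⟩
    rw [abs_lt] at h2
    exact ⟨le_of_lt h3, by linarith⟩
  -- The folded half-line covers the hole around a, which the annulus omits; the hole is the extra
  -- term that vanishes as ε → 0.
  have hqle : ∫ s in Ioc 0 (Z - a), q s ≤
      (∫ s in A ∩ Ioi 0, q s) + ∫ s in Icc (a - ε) (a + ε), q s := by
    have hIcc : Icc (a - ε) (a + ε) ⊆ Icc 0 (a + Z) :=
      fun s hs => ⟨by linarith [hs.1], by linarith [hs.2]⟩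
    rw [← setIntegral_union _ measurableSet_Icc (hqI _ hApos) (hqI _ hIcc)]
    · refine setIntegral_mono_set (hqI _ (union_subset hApos hIcc)) ?_ ?_
      · refine (ae_restrict_iff' ((hAo.measurableSet.inter measurableSet_Ioi).union
          measurableSet_Icc)).2 (Eventually.of_forall ?_)
        rintro s (hs | hs)
        · exact hq0 s hs.2
        · exact hq0 s (by linarith [hs.1])
      · refine LE.le.eventuallyLE fun s hs => ?_
        by_cases h : ε < |a - s|
        · left
          refine ⟨⟨h, ?_⟩, hs.1⟩
          rw [abs_lt]
          constructor <;> linarith [hs.1, hs.2]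
        · right
          rw [not_lt, abs_le] at h
          exact ⟨by linarith [h.2], by linarith [h.1]⟩
    · refine Set.disjoint_left.2 fun y hy hy' => ?_
      have h1 := hy.1.1
      rw [lt_abs] at h1
      rcases h1 with h1 | h1 <;> linarith [hy'.1, hy'.2]
  have hplus : (∫ y in A ∩ Ioi 0, f y) + (∫ s in A ∩ Ioi 0, q s) =
      -∫ s in A ∩ Ioi 0, (V s - V a) * (1 / (a - s) ^ 2 - 1 / (a + s) ^ 2) := by
    rw [← integral_add (hfA.mono_set inter_subset_left) (hqI _ hApos), ← integral_neg]
    refine setIntegral_congr_fun (hAo.measurableSet.inter measurableSet_Ioi) fun s _ => ?_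
    simp only [hf, hq, sq_abs]
    ring
  have hmono : ∫ s in E, (V s - V a) * (1 / (a - s) ^ 2 - 1 / (a + s) ^ 2) ≤
      ∫ s in A ∩ Ioi 0, (V s - V a) * (1 / (a - s) ^ 2 - 1 / (a + s) ^ 2) := by
    refine setIntegral_mono_set ?_ ?_ (LE.le.eventuallyLE hE)
    · refine (((hfA.mono_set inter_subset_left).add (hqI _ hApos)).neg).congr_fun (fun s _ => ?_)
        (hAo.measurableSet.inter measurableSet_Ioi)
      simp only [hf, hq, sq_abs, Pi.neg_apply, Pi.add_apply]
      ring
    · refine (ae_restrict_iff' (hAo.measurableSet.inter measurableSet_Ioi)).2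
        (Eventually.of_forall fun s hs => ?_)
      have hs0 : 0 < s := hs.2
      have hne := hKne s (hAK hs.1)
      refine mul_nonneg (sub_nonneg.2 (hmin s hs0)) (sub_nonneg.2 ?_)
      refine one_div_le_one_div_of_le (by positivity) ?_
      nlinarith
  rw [hsplit, hminus]
  linarith

/-- The kernel (a-y)/|a-y|² is odd about a. A linear term has no absolutely convergent tail, which
is why both radii of the truncation stay finite here. -/
theorem annulusIntegral_add_linear {V : ℝ → ℝ} (hV : Continuous V) {a ε Z κ : ℝ} (hε : 0 < ε) :
    ∫ y in {y : ℝ | ε < |a - y| ∧ |a - y| < Z}, (V a + κ * a - (V y + κ * y)) / |a - y| ^ 2 =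
      ∫ y in {y : ℝ | ε < |a - y| ∧ |a - y| < Z}, (V a - V y) / |a - y| ^ 2 := by
  set A : Set ℝ := {y : ℝ | ε < |a - y| ∧ |a - y| < Z} with hA
  have hint : ∀ F : ℝ → ℝ, Continuous F → IntegrableOn (fun y => F y / |a - y| ^ 2) A := by
    intro F hF
    refine (ContinuousOn.integrableOn_compact (isCompact_annulus a ε Z) ?_).mono_set fun y hy => ⟨hy.1.le, hy.2.le⟩
    refine ContinuousOn.div (by fun_prop) (by fun_prop) fun y hy => pow_ne_zero 2 ?_
    linarith [hy.1]
  have h0 : ∫ y in A, (κ * (a - y)) / |a - y| ^ 2 = 0 := by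
    have mp : MeasurePreserving (fun z : ℝ => 2 * a - z) volume volume :=
      Measure.measurePreserving_sub_left volume (2 * a)
    have e : MeasurableEmbedding (fun z : ℝ => 2 * a - z) :=
      (MeasurableEquiv.subLeft (2 * a)).measurableEmbedding
    have h1 := mp.setIntegral_preimage_emb e (fun y => (κ * (a - y)) / |a - y| ^ 2) A
    have habs : ∀ y, |a - (2 * a - y)| = |a - y| := fun y => by
      rw [show a - (2 * a - y) = -(a - y) by ring, abs_neg]
    have hpre : (fun z : ℝ => 2 * a - z) ⁻¹' A = A := by
      ext y
      simp only [hA, mem_preimage, mem_ofPred_eq, habs]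
    rw [hpre] at h1
    have h2 : ∫ y in A, (κ * (a - (2 * a - y))) / |a - (2 * a - y)| ^ 2 =
        -∫ y in A, (κ * (a - y)) / |a - y| ^ 2 := by
      rw [← integral_neg]
      congr 1
      ext y
      rw [habs]
      ring
    linarith
  have hEq : ∀ y, (V a + κ * a - (V y + κ * y)) / |a - y| ^ 2 =
      (V a - V y) / |a - y| ^ 2 + (κ * (a - y)) / |a - y| ^ 2 := fun y => by ring
  simp only [hEq]
  rw [integral_add (hint (fun y => V a - V y) (by fun_prop))
    (hint (fun y => κ * (a - y)) (by fun_prop)), h0, add_zero]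

theorem tendsto_annulusIntegral {φ : ℝ → ℝ} {a ε : ℝ} (ht : TailIntegrableAt φ a) (hε : 0 < ε) :
    Tendsto (fun Z : ℝ => ∫ y in {y : ℝ | ε < |a - y| ∧ |a - y| < Z}, (φ a - φ y) / |a - y| ^ 2)
      atTop (𝓝 (∫ y in {y : ℝ | ε < |a - y|}, (φ a - φ y) / |a - y| ^ 2)) := by
  have hU : {y : ℝ | ε < |a - y|} = ⋃ Z : ℝ, {y : ℝ | ε < |a - y| ∧ |a - y| < Z} := by
    ext y
    simp only [mem_ofPred_eq, mem_iUnion]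
    exact ⟨fun h => ⟨|a - y| + 1, h, by linarith⟩, fun ⟨_, h, _⟩ => h⟩
  have hi := ht ε hε
  rw [hU] at hi ⊢
  exact tendsto_setIntegral_of_monotone (fun Z => (isOpen_annulus a ε Z).measurableSet)
    (fun Z Z' hZ y hy => ⟨hy.1, hy.2.trans_le hZ⟩) hi

theorem tendsto_setIntegral_Icc_shrink {q : ℝ → ℝ} {a : ℝ} (hq : ContinuousAt q a) :
    Tendsto (fun ε : ℝ => ∫ s in Icc (a - ε) (a + ε), q s) (𝓝[>] 0) (𝓝 0) := by
  obtain ⟨δ, hδ, hb⟩ := Metric.continuousAt_iff.1 hq 1 one_pos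
  have hlim : Tendsto (fun ε : ℝ => (|q a| + 1) * (2 * ε)) (𝓝[>] 0) (𝓝 0) := by
    have : Tendsto (fun ε : ℝ => (|q a| + 1) * (2 * ε)) (𝓝 0) (𝓝 ((|q a| + 1) * (2 * 0))) :=
      Continuous.tendsto (by fun_prop) 0
    simpa using this.mono_left nhdsWithin_le_nhds
  refine squeeze_zero_norm' ?_ hlim
  filter_upwards [Ioo_mem_nhdsGT hδ] with ε hε
  have := norm_setIntegral_le_of_norm_le_const (μ := volume) (f := q) (C := |q a| + 1)
    (s := Icc (a - ε) (a + ε)) (by simp) (fun s hs => ?_)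
  · refine this.trans (le_of_eq ?_)
    rw [Real.volume_real_Icc_of_le (by linarith [hε.1])]
    ring
  · have h1 : dist s a < δ := by
      rw [Real.dist_eq, abs_lt]
      constructor <;> linarith [hs.1, hs.2, hε.2]
    have h2 := hb h1
    rw [Real.dist_eq] at h2
    rw [Real.norm_eq_abs]
    have := abs_sub_abs_le_abs_sub (q s) (q a)
    linarith

/-- The common estimate behind the maximum principles for odd functions. -/
theorem HasHalfLaplacianAt.le_of_odd_of_min {V : ℝ → ℝ} {L a κ : ℝ}
    (hL : HasHalfLaplacianAt V L a) (ht : TailIntegrableAt V a) (hV : Continuous V)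
    (hodd : ∀ s, V (-s) = -V s) (ha : 0 < a) (hmin : ∀ s, 0 < s → V a + κ * a ≤ V s + κ * s)
    {E : Set ℝ} {η M : ℝ} (hη : 0 < η) (hE : E ⊆ {y : ℝ | η ≤ |a - y| ∧ |a - y| < M} ∩ Ioi 0) :
    Real.pi * L ≤ 2 * (V a + κ * a) / a -
      ∫ s in E, (V s + κ * s - (V a + κ * a)) * (1 / (a - s) ^ 2 - 1 / (a + s) ^ 2) := by
  set J := ∫ s in E, (V s + κ * s - (V a + κ * a)) * (1 / (a - s) ^ 2 - 1 / (a + s) ^ 2) with hJ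
  set V' : ℝ → ℝ := fun s => V s + κ * s with hV'
  have hV'c : Continuous V' := by fun_prop
  have hodd' : ∀ s, V' (-s) = -V' s := fun s => by simp only [hV', hodd]; ring
  set q : ℝ → ℝ := fun s => (V' s - V' a) / (a + s) ^ 2 with hq
  have hqc : ContinuousAt q a :=
    ContinuousAt.div (by fun_prop) (by fun_prop) (by positivity)
  -- Here Z → ∞ with ε fixed; ε → 0 comes afterwards. The bounds η and M place `E` inside every such
  -- annulus eventually.
  have key : ∀ ε : ℝ, ε ∈ Ioo 0 (min a η) →
      ∫ y in {y : ℝ | ε < |a - y|}, (V a - V y) / |a - y| ^ 2 ≤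
        2 * V' a * (1 / a) + (∫ s in Icc (a - ε) (a + ε), q s) - J := by
    intro ε hε
    have h0 := hε.1
    have h1 : ε < a := hε.2.trans_le (min_le_left _ _)
    have h2 : ε < η := hε.2.trans_le (min_le_right _ _)
    have hlim : Tendsto (fun Z : ℝ => 2 * V' a * (1 / a - 1 / Z) +
        (∫ s in Icc (a - ε) (a + ε), q s) - J) atTop
        (𝓝 (2 * V' a * (1 / a - 0) + (∫ s in Icc (a - ε) (a + ε), q s) - J)) := by
      have hz : Tendsto (fun Z : ℝ => 1 / Z) atTop (𝓝 0) := by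
        simpa using tendsto_inv_atTop_zero (𝕜 := ℝ)
      exact (((hz.const_sub _).const_mul _).add_const _).sub_const _
    rw [sub_zero] at hlim
    refine le_of_tendsto_of_tendsto (tendsto_annulusIntegral ht h0) hlim ?_
    filter_upwards [eventually_gt_atTop a, eventually_gt_atTop M] with Z hZ hZM
    rw [← annulusIntegral_add_linear hV (κ := κ) h0]
    exact annulusIntegral_le_of_odd hV'c hodd' h0 h1 hZ hmin
      fun s hs => ⟨⟨h2.trans_le (hE hs).1.1, (hE hs).1.2.trans hZM⟩, (hE hs).2⟩
  have hlim := ((tendsto_setIntegral_Icc_shrink hqc).const_add (2 * V' a * (1 / a))).sub_const J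
  have : Real.pi * L ≤ 2 * V' a * (1 / a) + 0 - J := by
    refine le_of_tendsto_of_tendsto hL.tendsto_tailIntegral hlim ?_
    filter_upwards [Ioo_mem_nhdsGT (lt_min ha hη)] with ε hε using key ε hε
  refine this.trans (le_of_eq ?_)
  simp only [hV']
  ring

/-- At a minimum over `(0, ∞)` of an odd function plus a linear one. -/
theorem HasHalfLaplacianAt.le_two_mul_div_of_odd {V : ℝ → ℝ} {L a κ : ℝ}
    (hL : HasHalfLaplacianAt V L a) (ht : TailIntegrableAt V a) (hV : Continuous V)
    (hodd : ∀ s, V (-s) = -V s) (ha : 0 < a) (hmin : ∀ s, 0 < s → V a + κ * a ≤ V s + κ * s) :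
    Real.pi * L ≤ 2 * (V a + κ * a) / a := by
  have := hL.le_of_odd_of_min ht hV hodd ha hmin (E := ∅) (M := 0) one_pos (empty_subset _)
  simpa using this

/-- Strong maximum principle for odd functions. -/
theorem HasHalfLaplacianAt.neg_of_odd {V : ℝ → ℝ} {L a b : ℝ}
    (hL : HasHalfLaplacianAt V L a) (ht : TailIntegrableAt V a) (hV : Continuous V)
    (hodd : ∀ s, V (-s) = -V s) (ha : 0 < a) (hVa : V a = 0) (hnn : ∀ s, 0 < s → 0 ≤ V s)
    (hb : 0 < b) (hVb : 0 < V b) : L < 0 := by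
  have hab : a ≠ b := fun h => by rw [h] at hVa; linarith
  have hev : ∀ᶠ s in 𝓝 b, 0 < V s ∧ 0 < s ∧ |a - b| / 2 < |a - s| ∧ |a - s| < |a - b| + 1 := by
    have hpos : 0 < |a - b| := abs_pos.2 (sub_ne_zero.2 hab)
    have hc : ContinuousAt (fun s => |a - s|) b := by fun_prop
    refine (hV.continuousAt.eventually (lt_mem_nhds hVb)).and ((lt_mem_nhds hb).and ?_)
    exact (hc.eventually (lt_mem_nhds (by linarith))).and
      (hc.eventually (gt_mem_nhds (by linarith)))
  obtain ⟨p, r, hpr, hsub⟩ := mem_nhds_iff_exists_Ioo_subset.1 hev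
  have hη : 0 < |a - b| / 2 := by
    have hpos : 0 < |a - b| := abs_pos.2 (sub_ne_zero.2 hab)
    linarith
  have hpr' : (p + b) / 2 < (b + r) / 2 := by linarith [hpr.1, hpr.2]
  have hsub' : Icc ((p + b) / 2) ((b + r) / 2) ⊆ Ioo p r :=
    fun s hs => ⟨by linarith [hs.1, hpr.1], by linarith [hs.2, hpr.2]⟩
  -- `E` is a small interval around b, away from a, on which V > 0.
  have main := hL.le_of_odd_of_min ht hV hodd ha (κ := 0) (by simpa [hVa] using hnn)
    (E := Ioc ((p + b) / 2) ((b + r) / 2)) (M := |a - b| + 1) hη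
    fun s hs => by
      obtain ⟨-, h1, h2, h3⟩ := hsub (hsub' (Ioc_subset_Icc_self hs))
      exact ⟨⟨h2.le, h3⟩, h1⟩
  simp only [zero_mul, add_zero, hVa, mul_zero, zero_div, zero_sub, sub_zero] at main
  have hI : 0 < ∫ s in Ioc ((p + b) / 2) ((b + r) / 2), V s * (1 / (a - s) ^ 2 - 1 / (a + s) ^ 2) := by
    rw [← intervalIntegral.integral_of_le hpr'.le]
    have hne : ∀ s ∈ Icc ((p + b) / 2) ((b + r) / 2), a - s ≠ 0 ∧ 0 < s ∧ 0 < V s := by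
      intro s hs
      obtain ⟨h0, h1, h2, h3⟩ := hsub (hsub' hs)
      exact ⟨abs_pos.1 (hη.trans h2), h1, h0⟩
    refine intervalIntegral.intervalIntegral_pos_of_pos_on ?_ ?_ hpr'
    · refine ContinuousOn.intervalIntegrable ?_
      rw [uIcc_of_le hpr'.le]
      refine hV.continuousOn.mul (ContinuousOn.sub ?_ ?_)
      · exact continuousOn_const.div (by fun_prop) fun s hs => pow_ne_zero 2 (hne s hs).1
      · exact continuousOn_const.div (by fun_prop)
          fun s hs => pow_ne_zero 2 (by linarith [(hne s hs).2.1])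
    · intro s hs
      obtain ⟨h1, h2, h3⟩ := hne s (Ioo_subset_Icc_self hs)
      refine mul_pos h3 (sub_pos.2 (one_div_lt_one_div_of_lt (by positivity) ?_))
      nlinarith
  have : Real.pi * L < 0 := by linarith
  exact (mul_neg_iff.1 this).elim (fun h => h.2) fun h => absurd h.1 (not_lt.2 Real.pi_pos.le)

/-! ### Quadratic decay of subsolutions by a barrier -/

theorem integrable_inv_sq_add_sub_sq {ρ : ℝ} (hρ : 0 < ρ) (c : ℝ) :
    Integrable (fun z : ℝ => 1 / (ρ ^ 2 + (c - z) ^ 2)) ∧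
      ∫ z : ℝ, 1 / (ρ ^ 2 + (c - z) ^ 2) = Real.pi / ρ := by
  have hEq : (fun z : ℝ => 1 / (ρ ^ 2 + (c - z) ^ 2)) =
      fun z => (1 / ρ ^ 2) * (fun t : ℝ => (1 + (t / ρ) ^ 2)⁻¹) (c - z) := by
    ext z
    field_simp
  have h1 : Integrable (fun t : ℝ => (1 + (t / ρ) ^ 2)⁻¹) :=
    integrable_inv_one_add_sq.comp_div hρ.ne'
  have h2 : ∫ t : ℝ, (1 + (t / ρ) ^ 2)⁻¹ = ρ * Real.pi := by
    rw [Measure.integral_comp_div (fun t : ℝ => (1 + t ^ 2)⁻¹) ρ, integral_univ_inv_one_add_sq,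
      abs_of_pos hρ, smul_eq_mul]
  rw [hEq]
  refine ⟨(h1.comp_sub_left c).const_mul _, ?_⟩
  rw [integral_const_mul, integral_sub_left_eq_self (fun t : ℝ => (1 + (t / ρ) ^ 2)⁻¹), h2]
  field_simp

theorem setIntegral_inv_sq_add_sub_sq_le {ρ : ℝ} (hρ : 0 < ρ) (c : ℝ) :
    ∫ z in Ioi (0 : ℝ), 1 / (ρ ^ 2 + (c - z) ^ 2) ≤ Real.pi / ρ := by
  obtain ⟨h1, h2⟩ := integrable_inv_sq_add_sub_sq hρ c
  rw [← h2]
  exact setIntegral_le_integral h1 (Eventually.of_forall fun z => by positivity)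

/-- For x ≥ 0 the factor ρ² + (x+z)² absorbs the numerator 2(ρ² + z² - 3x²), leaving a Cauchy kernel
of total mass π/ρ. Integrated, |(-Δ)^{1/2}φ| ≤ (6/ρ)φ for φ = 1/(ρ²+x²); with ρ = 6, φ is a
supersolution of (-Δ)^{1/2}φ + φ ≥ 0. -/
theorem abs_secondDifference_inv_le {ρ : ℝ} (hρ : 0 < ρ) (x : ℝ) {z : ℝ} (hz : 0 < z) :
    |(2 * (1 / (ρ ^ 2 + x ^ 2)) - 1 / (ρ ^ 2 + (x + z) ^ 2) - 1 / (ρ ^ 2 + (x - z) ^ 2)) / z ^ 2| ≤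
      6 * (1 / (ρ ^ 2 + x ^ 2)) * (1 / (ρ ^ 2 + (|x| - z) ^ 2)) := by
  wlog hx : 0 ≤ x generalizing x
  · have := this (-x) (by linarith)
    rw [abs_neg x, neg_sq, show (-x + z) ^ 2 = (x - z) ^ 2 by ring,
      show (-x - z) ^ 2 = (x + z) ^ 2 by ring, sub_right_comm] at this
    exact this
  rw [abs_of_nonneg hx]
  have hD : 0 < ρ ^ 2 + x ^ 2 := by positivity
  have hP : 0 < ρ ^ 2 + (x + z) ^ 2 := by positivity
  have hQ : 0 < ρ ^ 2 + (x - z) ^ 2 := by positivity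
  have hEq : (2 * (1 / (ρ ^ 2 + x ^ 2)) - 1 / (ρ ^ 2 + (x + z) ^ 2) -
      1 / (ρ ^ 2 + (x - z) ^ 2)) / z ^ 2 = 2 * (ρ ^ 2 + z ^ 2 - 3 * x ^ 2) / (ρ ^ 2 + (x + z) ^ 2) *
        (1 / (ρ ^ 2 + x ^ 2)) * (1 / (ρ ^ 2 + (x - z) ^ 2)) := by
    field_simp
    ring
  rw [hEq, abs_mul, abs_mul, abs_of_pos (one_div_pos.2 hD), abs_of_pos (one_div_pos.2 hQ)]
  gcongr
  rw [abs_div, abs_of_pos hP, div_le_iff₀ hP, abs_le]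
  have := mul_nonneg hx hz.le
  constructor <;> nlinarith [sq_nonneg ρ, sq_nonneg x, sq_nonneg z]

/-- Bounded subsolutions of `(-Δ)^{1/2} u + u ≤ 0` near infinity decay quadratically. -/
theorem exists_quadratic_decay {u : ℝ → ℝ} (hu : Continuous u) (ht : ∀ x, TailIntegrableAt u x)
    {M R : ℝ} (hM0 : 0 ≤ M) (hM : ∀ x, u x ≤ M)
    (hsub : ∀ x, R < |x| → ∃ L, HasHalfLaplacianAt u L x ∧ L + u x ≤ 0) :
    ∃ A : ℝ, 0 ≤ A ∧ ∀ x, u x ≤ A * (1 / (6 ^ 2 + x ^ 2)) := by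
  -- Makes A/(36+x²) ≥ M ≥ u on |x| ≤ R.
  set A : ℝ := M * (6 ^ 2 + R ^ 2) with hA
  have hA0 : 0 ≤ A := by positivity
  refine ⟨A, hA0, ?_⟩
  -- The first term handles |x| ≤ R; the second brings the barrier above M at infinity, its 6/ρ
  -- compensating its half-Laplacian, and it vanishes as ρ → ∞. At a positive maximum of u - B one
  -- has |x| > R and L ≥ -B(x) > -u(x), contradicting L + u ≤ 0.
  have barrier : ∀ ρ : ℝ, 0 < ρ → ∀ y, u y ≤ A * (1 / (6 ^ 2 + y ^ 2)) +
      (M + 1) * (1 - ρ ^ 2 * (1 / (ρ ^ 2 + y ^ 2)) + 6 / ρ) := by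
    intro ρ hρ y
    by_contra hy
    rw [not_le] at hy
    set B : ℝ → ℝ := fun y => A * (1 / (6 ^ 2 + y ^ 2)) +
      (M + 1) * (1 - ρ ^ 2 * (1 / (ρ ^ 2 + y ^ 2)) + 6 / ρ) with hB
    have hBc : Continuous B := by
      have h1 : Continuous fun y : ℝ => 1 / ((6 : ℝ) ^ 2 + y ^ 2) :=
        continuous_const.div (by fun_prop) fun y => by positivity
      have h2 : Continuous fun y : ℝ => 1 / (ρ ^ 2 + y ^ 2) :=
        continuous_const.div (by fun_prop) fun y => by positivity
      fun_prop
    have hfar : ∀ᶠ x in cocompact ℝ, u x - B x ≤ u y - B y := by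
      filter_upwards [(tendsto_norm_cocompact_atTop (E := ℝ)).eventually_ge_atTop
        ((M + 1) * ρ ^ 2 + 1)] with x hx
      rw [Real.norm_eq_abs] at hx
      have h1 : (M + 1) * ρ ^ 2 ≤ x ^ 2 := by
        rw [← sq_abs x]
        nlinarith [mul_nonneg (by linarith : 0 ≤ M + 1) (sq_nonneg ρ)]
      have hpos : 0 < ρ ^ 2 + x ^ 2 := by positivity
      have h2 : (M + 1) * (ρ ^ 2 * (1 / (ρ ^ 2 + x ^ 2))) ≤ 1 := by
        rw [← mul_assoc, mul_one_div, div_le_one hpos]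
        nlinarith [sq_nonneg ρ]
      have h3 : 0 ≤ A * (1 / (6 ^ 2 + x ^ 2)) := by positivity
      have h4 : 0 ≤ (M + 1) * (6 / ρ) := by positivity
      have h5 : B x = A * (1 / (6 ^ 2 + x ^ 2)) + (M + 1) -
        (M + 1) * (ρ ^ 2 * (1 / (ρ ^ 2 + x ^ 2))) + (M + 1) * (6 / ρ) := by
        simp only [hB]; ring
      have h6 : B y < u y := hy
      linarith [hM x]
    obtain ⟨x, hx⟩ := (hu.sub hBc).exists_forall_ge' y hfar
    have hxB : B x < u x := by
      have h1 := hx y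
      have h6 : B y < u y := hy
      simp only [Pi.sub_apply] at h1
      linarith
    have hρle : ∀ x : ℝ, ρ ^ 2 * (1 / (ρ ^ 2 + x ^ 2)) ≤ 1 := by
      intro x
      rw [mul_one_div, div_le_one (by positivity)]
      nlinarith [sq_nonneg x]
    have hBx : A * (1 / (6 ^ 2 + x ^ 2)) + 6 * (M + 1) / ρ ≤ B x := by
      have h2 : 0 ≤ (M + 1) * (1 - ρ ^ 2 * (1 / (ρ ^ 2 + x ^ 2))) :=
        mul_nonneg (by linarith) (by linarith [hρle x])
      have h3 : B x = A * (1 / (6 ^ 2 + x ^ 2)) +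
        (M + 1) * (1 - ρ ^ 2 * (1 / (ρ ^ 2 + x ^ 2))) + 6 * (M + 1) / ρ := by
        simp only [hB]; ring
      linarith
    have hxR : R < |x| := by
      by_contra hcon
      rw [not_lt] at hcon
      have h1 : x ^ 2 ≤ R ^ 2 := by
        rw [← sq_abs x]
        have := abs_nonneg x
        gcongr
      have h2 : M ≤ A * (1 / (6 ^ 2 + x ^ 2)) := by
        rw [mul_one_div, le_div_iff₀ (by positivity), hA]
        gcongr
      have h3 : 0 ≤ 6 * (M + 1) / ρ := by positivity
      linarith [hM x]
    obtain ⟨L, hL, hLu⟩ := hsub x hxR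
    set h : ℝ → ℝ := fun z => -((A * (6 * (1 / (6 ^ 2 + x ^ 2)))) * (1 / (6 ^ 2 + (|x| - z) ^ 2)) +
      ((M + 1) * (ρ ^ 2 * (6 * (1 / (ρ ^ 2 + x ^ 2))))) * (1 / (ρ ^ 2 + (|x| - z) ^ 2))) with hh
    have hi6 := (integrable_inv_sq_add_sub_sq (ρ := 6) (by norm_num) |x|).1.integrableOn
      (s := Ioi 0)
    have hiρ := (integrable_inv_sq_add_sub_sq hρ |x|).1.integrableOn (s := Ioi 0)
    have hint : IntegrableOn h (Ioi 0) := ((hi6.const_mul _).add (hiρ.const_mul _)).neg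
    have hge := hL.ge_of_le_secondDifference (ht x) hint ?_
    · have hval : -(Real.pi * (A * (1 / (6 ^ 2 + x ^ 2)) + 6 * (M + 1) / ρ)) ≤
          ∫ z in Ioi 0, h z := by
        simp only [hh]
        rw [integral_neg, integral_add (hi6.const_mul _) (hiρ.const_mul _), integral_const_mul,
          integral_const_mul, neg_le_neg_iff]
        have h1 := setIntegral_inv_sq_add_sub_sq_le (ρ := 6) (by norm_num) |x|
        have h2 := setIntegral_inv_sq_add_sub_sq_le hρ |x|
        have h3 : A * (6 * (1 / (6 ^ 2 + x ^ 2))) *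
            (∫ z in Ioi (0 : ℝ), 1 / (6 ^ 2 + (|x| - z) ^ 2)) ≤
            A * (6 * (1 / (6 ^ 2 + x ^ 2))) * (Real.pi / 6) := by gcongr
        have h4 : (M + 1) * (ρ ^ 2 * (6 * (1 / (ρ ^ 2 + x ^ 2)))) *
            (∫ z in Ioi (0 : ℝ), 1 / (ρ ^ 2 + (|x| - z) ^ 2)) ≤ (M + 1) * 6 * (Real.pi / ρ) := by
          have h5 : ρ ^ 2 * (6 * (1 / (ρ ^ 2 + x ^ 2))) ≤ 6 := by linarith [hρle x]
          have h6 : 0 ≤ ∫ z in Ioi (0 : ℝ), 1 / (ρ ^ 2 + (|x| - z) ^ 2) :=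
            integral_nonneg fun z => by positivity
          gcongr
        refine (add_le_add h3 h4).trans (le_of_eq ?_)
        ring
      have h1 := hval.trans hge
      have h2 : -(A * (1 / (6 ^ 2 + x ^ 2)) + 6 * (M + 1) / ρ) ≤ L := by
        rw [← mul_neg] at h1
        exact le_of_mul_le_mul_left h1 Real.pi_pos
      linarith
    · intro z hz
      have hx1 := hx (x + z)
      have hx2 := hx (x - z)
      simp only [Pi.sub_apply] at hx1 hx2
      have hz2 : 0 < z ^ 2 := by positivity
      have e1 := (abs_le.1 (abs_secondDifference_inv_le (ρ := 6) (by norm_num) x hz)).1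
      have e2 := (abs_le.1 (abs_secondDifference_inv_le hρ x hz)).2
      have e1' := mul_le_mul_of_nonneg_left e1 hA0
      have e2' := mul_le_mul_of_nonneg_left e2
        (mul_nonneg (by linarith : 0 ≤ M + 1) (sq_nonneg ρ))
      have hBd : (2 * B x - B (x + z) - B (x - z)) / z ^ 2 ≤
          (2 * u x - u (x + z) - u (x - z)) / z ^ 2 := by
        gcongr ?_ / _
        linarith
      refine le_trans ?_ hBd
      have : (2 * B x - B (x + z) - B (x - z)) / z ^ 2 =
          A * ((2 * (1 / (6 ^ 2 + x ^ 2)) - 1 / (6 ^ 2 + (x + z) ^ 2) -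
            1 / (6 ^ 2 + (x - z) ^ 2)) / z ^ 2) - (M + 1) * ρ ^ 2 *
          ((2 * (1 / (ρ ^ 2 + x ^ 2)) - 1 / (ρ ^ 2 + (x + z) ^ 2) -
            1 / (ρ ^ 2 + (x - z) ^ 2)) / z ^ 2) := by
        simp only [hB]; ring
      rw [this]
      simp only [hh]
      linarith
  intro y
  have hlim : Tendsto (fun ρ : ℝ => A * (1 / (6 ^ 2 + y ^ 2)) +
      (M + 1) * (y ^ 2 * (1 / ρ) ^ 2 + 6 * (1 / ρ))) atTop
      (𝓝 (A * (1 / (6 ^ 2 + y ^ 2)) + (M + 1) * (y ^ 2 * 0 ^ 2 + 6 * 0))) := by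
    have hz : Tendsto (fun ρ : ℝ => 1 / ρ) atTop (𝓝 0) := by
      simpa using tendsto_inv_atTop_zero (𝕜 := ℝ)
    exact ((((hz.pow 2).const_mul _).add (hz.const_mul _)).const_mul _).const_add _
  have : u y ≤ A * (1 / (6 ^ 2 + y ^ 2)) + (M + 1) * (y ^ 2 * 0 ^ 2 + 6 * 0) := by
    refine ge_of_tendsto hlim ?_
    filter_upwards [eventually_gt_atTop 0] with ρ hρ
    refine (barrier ρ hρ y).trans ?_
    have h1 : 1 - ρ ^ 2 * (1 / (ρ ^ 2 + y ^ 2)) ≤ y ^ 2 * (1 / ρ) ^ 2 := by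
      have : 1 - ρ ^ 2 * (1 / (ρ ^ 2 + y ^ 2)) = y ^ 2 * (1 / (ρ ^ 2 + y ^ 2)) := by
        field_simp
        ring
      rw [this, one_div_pow]
      gcongr
      nlinarith [sq_nonneg y]
    have h2 : 6 / ρ = 6 * (1 / ρ) := by ring
    have h3 : 0 ≤ M + 1 := by linarith
    rw [h2]
    gcongr
  simpa using this

/-! ### Sublinear lower bound for half-superharmonic functions -/

theorem integral_Ioi_one_div_sq {ρ : ℝ} (hρ : 0 < ρ) :
    IntegrableOn (fun z : ℝ => 1 / z ^ 2) (Ioi ρ) ∧ ∫ z in Ioi ρ, 1 / z ^ 2 = 1 / ρ := by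
  have hEq : EqOn (fun z : ℝ => z ^ (-2 : ℝ)) (fun z : ℝ => 1 / z ^ 2) (Ioi ρ) := by
    intro z hz
    have hz0 : 0 < z := hρ.trans hz
    simp only
    rw [Real.rpow_neg hz0.le, Real.rpow_two, one_div]
  refine ⟨(integrableOn_Ioi_rpow_of_lt (by norm_num) hρ).congr_fun hEq measurableSet_Ioi, ?_⟩
  rw [← setIntegral_congr_fun measurableSet_Ioi hEq, integral_Ioi_rpow_of_lt (by norm_num) hρ]
  norm_num
  rw [Real.rpow_neg_one]

/-- With p = r - |s| and z ≤ p/8, both denominators are at least pr/2, while the exact numerator is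
at most 10r²z². -/
theorem secondDifference_inv_parabola_le {r s z : ℝ} (hs : |s| < r)
    (hz : 0 ≤ z) (hzp : 8 * z ≤ r - |s|) :
    (r ^ 2 - s ^ 2) / (r ^ 2 - (s + z) ^ 2) + (r ^ 2 - s ^ 2) / (r ^ 2 - (s - z) ^ 2) - 2 ≤
      40 * z ^ 2 / (r - |s|) ^ 2 := by
  set p := r - |s| with hp
  have hp0 : 0 < p := by linarith
  have hr : 0 < r := (abs_nonneg s).trans_lt hs
  have hs1 := le_abs_self s
  have hs2 := neg_abs_le s
  have hpr : p ≤ r := by linarith [abs_nonneg s]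
  have lower : ∀ t, |t| ≤ r - p / 2 → p * r / 2 ≤ r ^ 2 - t ^ 2 := by
    intro t ht
    have h1 : r ^ 2 - t ^ 2 = (r - |t|) * (r + |t|) := by rw [← sq_abs t]; ring
    have h2 := abs_nonneg t
    rw [h1]
    nlinarith
  have hP := lower (s + z) (by rw [abs_le]; constructor <;> linarith)
  have hQ := lower (s - z) (by rw [abs_le]; constructor <;> linarith)
  have hpr0 : 0 < p * r / 2 := by positivity
  have hP0 := hpr0.trans_le hP
  have hQ0 := hpr0.trans_le hQ
  have hEq : (r ^ 2 - s ^ 2) / (r ^ 2 - (s + z) ^ 2) + (r ^ 2 - s ^ 2) / (r ^ 2 - (s - z) ^ 2) - 2 =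
      2 * z ^ 2 * (r ^ 2 + 3 * s ^ 2 - z ^ 2) / ((r ^ 2 - (s + z) ^ 2) * (r ^ 2 - (s - z) ^ 2)) := by
    field_simp
    ring
  have hs3 : s ^ 2 ≤ r ^ 2 := by
    rw [← sq_abs s]
    have := abs_nonneg s
    gcongr
  rw [hEq]
  calc 2 * z ^ 2 * (r ^ 2 + 3 * s ^ 2 - z ^ 2) / ((r ^ 2 - (s + z) ^ 2) * (r ^ 2 - (s - z) ^ 2))
      ≤ 2 * z ^ 2 * (5 * r ^ 2) / ((p * r / 2) * (p * r / 2)) := by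
        gcongr
        nlinarith [sq_nonneg z]
    _ = 40 * z ^ 2 / p ^ 2 := by
        field_simp
        ring

-- Touch -w from above by a multiple of 1/(R² - (y-x₀)²), which blows up at the ends of the
-- interval. At the contact point, L ≥ 0 bounds the contact value by the weighted integral of |w|,
-- which tends to 0 as |x₀| → ∞.
set_option maxHeartbeats 1000000 in
theorem neg_le_of_superharmonic {w : ℝ → ℝ} (hw : Continuous w) (hm : MemLHalf w)
    (hsuper : ∀ x, ∃ L, 0 ≤ L ∧ HasHalfLaplacianAt w L x) {x₀ : ℝ} (hx₀ : 1 ≤ |x₀|) :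
    -w x₀ ≤ 256 * |x₀| * ∫ y, |w y| / (|x₀| ^ 2 + y ^ 2) := by
  set R := |x₀| with hR
  set q : ℝ → ℝ := fun y => |w y| / (R ^ 2 + y ^ 2) with hq
  have hR0 : 0 < R := by linarith
  have hq0 : ∀ y, 0 ≤ q y := fun y => by positivity
  have hqi : Integrable q := by
    refine Integrable.mono' hm.2 ?_ (Eventually.of_forall fun y => ?_)
    · exact (hw.abs.div (by fun_prop) fun y => by positivity).aestronglyMeasurable
    · rw [Real.norm_eq_abs, abs_of_nonneg (hq0 y), sq_abs]
      simp only [hq]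
      gcongr
      nlinarith
  set T := ∫ y, q y with hT
  have hT0 : 0 ≤ T := integral_nonneg hq0
  by_cases hneg : -w x₀ ≤ 0
  · exact hneg.trans (by positivity)
  rw [not_le] at hneg
  obtain ⟨x, hxI, hxmax⟩ := (isCompact_Icc (a := x₀ - R) (b := x₀ + R)).exists_isMaxOn
    ⟨x₀, by constructor <;> linarith⟩
    (f := fun y => -w y * (R ^ 2 - (y - x₀) ^ 2)) (by fun_prop)
  have hmax : ∀ y, |y - x₀| ≤ R →
      -w y * (R ^ 2 - (y - x₀) ^ 2) ≤ -w x * (R ^ 2 - (x - x₀) ^ 2) := by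
    intro y hy
    rw [abs_le] at hy
    exact hxmax (show y ∈ Icc (x₀ - R) (x₀ + R) from ⟨by linarith, by linarith⟩)
  have hmx₀ := hmax x₀ (by simp [hR0.le])
  rw [sub_self, zero_pow two_ne_zero, sub_zero] at hmx₀
  have hxR : |x - x₀| ≤ R := abs_le.2 ⟨by linarith [hxI.1], by linarith [hxI.2]⟩
  set D := R ^ 2 - (x - x₀) ^ 2 with hD
  have hDfac : D = (R - |x - x₀|) * (R + |x - x₀|) := by
    rw [hD, ← sq_abs (x - x₀)]; ring
  have hprod : 0 < -w x * D := lt_of_lt_of_le (by positivity) hmx₀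
  have hD0' : 0 ≤ D := by
    rw [hDfac]
    exact mul_nonneg (by linarith) (by positivity)
  have hD0 : 0 < D := lt_of_le_of_ne hD0' fun h => by rw [← h] at hprod; linarith
  set m := -w x with hmdef
  have hm0 : 0 < m := pos_of_mul_pos_left hprod hD0'
  set p := R - |x - x₀| with hp
  have hp0 : 0 < p := by
    refine lt_of_le_of_ne (by linarith) fun h => ?_
    rw [← h, zero_mul] at hDfac
    linarith
  have hpR : p ≤ R := by linarith [abs_nonneg (x - x₀)]
  -- p is the distance from x to the ends of the interval. The range z ≤ ρ contributes at most
  -- 40mρ/p² = (5/8)m/ρ and the tail -2m/ρ, leaving -(11/8)m/ρ.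
  set ρ := p / 8 with hρ
  have hρ0 : 0 < ρ := by positivity
  have hρR : ρ ≤ R := by linarith
  have hx2R : |x| ≤ 2 * R := by
    have := abs_add_le (x - x₀) x₀
    rw [sub_add_cancel] at this
    linarith
  obtain ⟨L, hL0, hL⟩ := hsuper x
  -- For |y-x| = z > ρ, R² + y² ≤ 9R² + 2z² ≤ cz², using |x| ≤ 2R and ρ ≤ R.
  set c := 11 * R ^ 2 / ρ ^ 2 with hc
  have hc0 : 0 ≤ c := by positivity
  set h₁ : ℝ → ℝ := (Ioc 0 ρ).indicator fun _ => 40 * m / p ^ 2 with hh₁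
  set h₂ : ℝ → ℝ := (Ioi ρ).indicator fun z => (-2 * m) * (1 / z ^ 2) with hh₂
  set h₃ : ℝ → ℝ := fun z => c * (q (x + z) + q (x - z)) with hh₃
  have i₁ : IntegrableOn h₁ (Ioi 0) := by
    rw [hh₁, integrableOn_indicator_iff measurableSet_Ioc]
    exact (integrableOn_const (s := Ioc 0 ρ) (by simp)).mono_set inter_subset_left
  have i₂ : IntegrableOn h₂ (Ioi 0) := by
    rw [hh₂, integrableOn_indicator_iff measurableSet_Ioi]
    exact IntegrableOn.mono_set ((integral_Ioi_one_div_sq hρ0).1.const_mul (-2 * m))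
      inter_subset_left
  have i₃' : Integrable h₃ := ((hqi.comp_add_left x).add (hqi.comp_sub_left x)).const_mul c
  have i₃ : IntegrableOn h₃ (Ioi 0) := i₃'.integrableOn
  have v₁ : ∫ z in Ioi 0, h₁ z = ρ * (40 * m / p ^ 2) := by
    rw [hh₁, setIntegral_indicator measurableSet_Ioc,
      inter_eq_right.2 Ioc_subset_Ioi_self, setIntegral_const,
      Real.volume_real_Ioc_of_le hρ0.le, sub_zero, smul_eq_mul]
  have v₂ : ∫ z in Ioi 0, h₂ z = (-2 * m) * (1 / ρ) := by
    rw [hh₂, setIntegral_indicator measurableSet_Ioi,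
      inter_eq_right.2 (Ioi_subset_Ioi hρ0.le), integral_const_mul, (integral_Ioi_one_div_sq hρ0).2]
  have v₃ : ∫ z in Ioi 0, h₃ z ≤ c * (2 * T) := by
    refine (setIntegral_le_integral i₃' (Eventually.of_forall fun z =>
      mul_nonneg hc0 (add_nonneg (hq0 _) (hq0 _)))).trans (le_of_eq ?_)
    rw [hh₃, integral_const_mul, integral_add (hqi.comp_add_left x) (hqi.comp_sub_left x),
      integral_add_left_eq_self q, integral_sub_left_eq_self q, ← hT]
    ring
  have hle := hL.le_of_secondDifference_le (hm.tailIntegrableAt x) (i₁.add (i₂.add i₃)) ?_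
  · have hsum : ∫ z in Ioi 0, (h₁ + (h₂ + h₃)) z =
        (∫ z in Ioi 0, h₁ z) + ((∫ z in Ioi 0, h₂ z) + ∫ z in Ioi 0, h₃ z) := by
      simp only [Pi.add_apply]
      rw [integral_add i₁, integral_add i₂ i₃]
      exact i₂.add i₃
    rw [hsum, v₁, v₂] at hle
    have hpL : 0 ≤ Real.pi * L := mul_nonneg Real.pi_pos.le hL0
    have h1 : 0 ≤ ρ * (40 * m / p ^ 2) + ((-2 * m) * (1 / ρ) + c * (2 * T)) := by linarith
    have hp8 : p = 8 * ρ := by rw [hρ]; ring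
    have h2 : ρ * (40 * m / p ^ 2) + ((-2 * m) * (1 / ρ) + c * (2 * T)) =
        (22 * R ^ 2 * T - (11 / 8) * (m * ρ)) / ρ ^ 2 := by
      rw [hp8, hc]
      field_simp
      ring
    rw [h2] at h1
    have h3 : 0 ≤ 22 * R ^ 2 * T - (11 / 8) * (m * ρ) := by
      by_contra hcon
      exact absurd h1 (not_le.2 (div_neg_of_neg_of_pos (not_le.1 hcon) (by positivity)))
    have h4 : D ≤ 16 * ρ * R := by
      rw [hDfac, hp8]
      nlinarith
    have h5 : -w x₀ * R ^ 2 ≤ 256 * R * T * R ^ 2 := by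
      refine hmx₀.trans ?_
      calc m * D ≤ m * (16 * ρ * R) := by gcongr
        _ = 16 * R * (m * ρ) := by ring
        _ ≤ 16 * R * (16 * R ^ 2 * T) :=
          mul_le_mul_of_nonneg_left (by linarith) (by positivity)
        _ = 256 * R * T * R ^ 2 := by ring
    exact le_of_mul_le_mul_right h5 (by positivity)
  · intro z hz
    have hz2 : 0 < z ^ 2 := by positivity
    simp only [Pi.add_apply]
    have hw2 : 2 * w x = -2 * m := by rw [hmdef]; ring
    by_cases hzρ : z ≤ ρ
    · have e1 : h₁ z = 40 * m / p ^ 2 := indicator_of_mem (show z ∈ Ioc 0 ρ from ⟨hz, hzρ⟩) _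
      have e2 : h₂ z = 0 := indicator_of_notMem (by simpa using hzρ) _
      have e3 : 0 ≤ h₃ z := mul_nonneg hc0 (add_nonneg (hq0 _) (hq0 _))
      have hquad := secondDifference_inv_parabola_le (r := R) (s := x - x₀) (z := z)
        (by linarith) hz.le (by linarith)
      have touch : ∀ y, |y - x₀| < R → -w y ≤ m * (D / (R ^ 2 - (y - x₀) ^ 2)) := by
        intro y hy
        have : 0 < R ^ 2 - (y - x₀) ^ 2 := by
          rw [← sq_abs (y - x₀)]
          nlinarith [abs_nonneg (y - x₀)]
        rw [← mul_div_assoc, le_div_iff₀ this]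
        exact hmax y hy.le
      have ha1 := le_abs_self (x - x₀)
      have ha2 := neg_abs_le (x - x₀)
      have t1 := touch (x + z) (by rw [abs_lt]; constructor <;> linarith)
      have t2 := touch (x - z) (by rw [abs_lt]; constructor <;> linarith)
      rw [show x + z - x₀ = x - x₀ + z by ring] at t1
      rw [show x - z - x₀ = x - x₀ - z by ring] at t2
      have hquad' := mul_le_mul_of_nonneg_left hquad hm0.le
      rw [e1, e2, div_le_iff₀ hz2]
      have h6 : 40 * m / p ^ 2 * z ^ 2 = m * (40 * z ^ 2 / p ^ 2) := by ring
      have h7 : 0 ≤ h₃ z * z ^ 2 := mul_nonneg e3 hz2.le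
      rw [zero_add, add_mul, h6]
      linarith
    · rw [not_le] at hzρ
      have e1 : h₁ z = 0 := indicator_of_notMem (fun h => absurd h.2 (not_le.2 hzρ)) _
      have e2 : h₂ z = (-2 * m) * (1 / z ^ 2) := indicator_of_mem (mem_Ioi.2 hzρ) _
      have bd : ∀ y, (y - x) ^ 2 = z ^ 2 → |w y| / z ^ 2 ≤ c * q y := by
        intro y hy
        have h8 : R ^ 2 + y ^ 2 ≤ c * z ^ 2 := by
          have hx2 : x ^ 2 ≤ 4 * R ^ 2 := by
            rw [← sq_abs x]
            nlinarith [abs_nonneg x]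
          have h9 : R ^ 2 + y ^ 2 ≤ 9 * R ^ 2 + 2 * z ^ 2 := by
            nlinarith [sq_nonneg (y - 2 * x)]
          have h10 : ρ ^ 2 ≤ z ^ 2 := by gcongr
          have h11 : ρ ^ 2 ≤ R ^ 2 := by gcongr
          rw [hc, div_mul_eq_mul_div, le_div_iff₀ (by positivity)]
          have h12 : R ^ 2 * ρ ^ 2 ≤ R ^ 2 * z ^ 2 := by gcongr
          have h13 : z ^ 2 * ρ ^ 2 ≤ z ^ 2 * R ^ 2 := by gcongr
          have h14 := mul_le_mul_of_nonneg_right h9 (sq_nonneg ρ)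
          linarith
        simp only [hq]
        rw [← mul_div_assoc, div_le_div_iff₀ hz2 (by positivity)]
        have := mul_le_mul_of_nonneg_left h8 (abs_nonneg (w y))
        linarith
      have b1 := bd (x + z) (by ring)
      have b2 := bd (x - z) (by ring)
      have hsplit : (2 * w x - w (x + z) - w (x - z)) / z ^ 2 ≤
          (-2 * m) * (1 / z ^ 2) + (|w (x + z)| / z ^ 2 + |w (x - z)| / z ^ 2) := by
        rw [hw2, mul_one_div, ← add_div, ← add_div]
        gcongr
        linarith [neg_abs_le (w (x + z)), neg_abs_le (w (x - z))]
      rw [e1, e2, zero_add]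
      refine hsplit.trans ?_
      simp only [hh₃]
      linarith

/-- Entire half-superharmonic functions are bounded below by a sublinear function. -/
theorem exists_neg_mul_abs_le_of_superharmonic {w : ℝ → ℝ} (hw : Continuous w) (hm : MemLHalf w)
    (hsuper : ∀ x, ∃ L, 0 ≤ L ∧ HasHalfLaplacianAt w L x) {δ : ℝ} (hδ : 0 < δ) :
    ∃ R : ℝ, ∀ x, R ≤ |x| → -(δ * |x|) ≤ w x := by
  have hlim : Tendsto (fun R : ℝ => ∫ y, |w y| / (R ^ 2 + y ^ 2)) atTop (𝓝 (∫ _ : ℝ, (0 : ℝ))) := by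
    refine tendsto_integral_filter_of_dominated_convergence (fun y => |w y| / (1 + |y| ^ 2))
      ?_ ?_ hm.2 ?_
    · filter_upwards [eventually_ge_atTop 1] with R hR
      exact (hw.abs.div (by fun_prop) fun y => by positivity).aestronglyMeasurable
    · filter_upwards [eventually_ge_atTop 1] with R hR
      refine Eventually.of_forall fun y => ?_
      rw [Real.norm_eq_abs, abs_of_nonneg (by positivity), sq_abs]
      gcongr
      nlinarith
    · refine Eventually.of_forall fun y => ?_
      refine Tendsto.div_atTop tendsto_const_nhds ?_
      exact tendsto_atTop_add_const_right _ _ (tendsto_pow_atTop two_ne_zero)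
  rw [integral_zero] at hlim
  obtain ⟨R, hR⟩ := eventually_atTop.1
    ((hlim.eventually (gt_mem_nhds (show 0 < δ / 256 by positivity))).and (eventually_ge_atTop 1))
  refine ⟨R, fun x hx => ?_⟩
  obtain ⟨h1, h2⟩ := hR |x| hx
  have h3 := neg_le_of_superharmonic hw hm hsuper h2
  have h4 : 256 * |x| * ∫ y, |w y| / (|x| ^ 2 + y ^ 2) ≤ 256 * |x| * (δ / 256) := by gcongr
  linarith

/-! ### Estimates for the reflected differences -/

theorem exists_isMin_of_neg {f : ℝ → ℝ} (hf : Continuous f) (hf0 : f 0 = 0) {s₀ : ℝ}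
    (hs₀ : 0 < s₀) (hneg : f s₀ < 0) (hev : ∀ᶠ s in atTop, f s₀ ≤ f s) :
    ∃ a, 0 < a ∧ f a ≤ f s₀ ∧ ∀ s, 0 < s → f a ≤ f s := by
  obtain ⟨T, hT⟩ := eventually_atTop.1 hev
  have hs₀mem : s₀ ∈ Icc 0 (max T s₀) := ⟨hs₀.le, le_max_right _ _⟩
  obtain ⟨a, ha, hmin⟩ := (isCompact_Icc (a := 0) (b := max T s₀)).exists_isMinOn
    ⟨s₀, hs₀mem⟩ hf.continuousOn
  have ha1 : f a ≤ f s₀ := hmin hs₀mem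
  refine ⟨a, lt_of_le_of_ne ha.1 fun h => ?_, ha1, fun s hs => ?_⟩
  · rw [← h, hf0] at ha1
    linarith
  · rcases le_total s (max T s₀) with h | h
    · exact hmin (show s ∈ Icc 0 (max T s₀) from ⟨hs.le, h⟩)
    · exact ha1.trans (hT s ((le_max_left _ _).trans h))

/-- A positive solution of the system together with the quantitative information used by the
moving plane method. -/
structure IsDecayingSolution (G : ℝ → ℝ) (θ K A : ℝ) (u w : ℝ → ℝ) : Prop where
  sol : IsClassicalSolution G θ u w
  differentiable : Differentiable ℝ G
  deriv_zero : deriv G 0 = 0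
  deriv_mono : MonotoneOn (deriv G) (Ici 0)
  K_nonneg : 0 ≤ K
  deriv_lip : ∀ a b, 0 ≤ a → a ≤ b → deriv G b - deriv G a ≤ K * (b - a)
  θ_pos : 0 < θ
  u_pos : ∀ x, 0 < u x
  A_nonneg : 0 ≤ A
  decay : ∀ x, u x ≤ A * (1 / (6 ^ 2 + x ^ 2))
  w_lim : Tendsto w (cocompact ℝ) atBot

theorem sub_nonneg_of_deriv_monotoneOn {G : ℝ → ℝ} (hG : Differentiable ℝ G)
    (hg0 : deriv G 0 = 0) (hg : MonotoneOn (deriv G) (Ici 0)) {a b : ℝ} (ha : 0 ≤ a)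
    (hab : a ≤ b) : 0 ≤ G b - G a ∧ G b - G a ≤ deriv G b * (b - a) := by
  rcases hab.eq_or_lt with rfl | hlt
  · simp
  obtain ⟨c, hc, hceq⟩ := exists_deriv_eq_slope G hlt hG.continuous.continuousOn
    hG.differentiableOn
  have hba : 0 < b - a := by linarith
  rw [eq_div_iff hba.ne'] at hceq
  have hc0 : 0 ≤ c := ha.trans hc.1.le
  rw [← hceq]
  constructor
  · refine mul_nonneg ?_ hba.le
    rw [← hg0]
    exact hg (mem_Ici.2 le_rfl) hc0 hc0
  · gcongr
    exact hg hc0 (hc0.trans hc.2.le) hc.2.le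

namespace IsDecayingSolution

variable {G u w : ℝ → ℝ} {θ K A : ℝ}

theorem continuous_u (h : IsDecayingSolution G θ K A u w) : Continuous u := h.sol.u_c11.1.continuous

theorem continuous_w (h : IsDecayingSolution G θ K A u w) : Continuous w := h.sol.w_c11.1.continuous

theorem deriv_nonneg (h : IsDecayingSolution G θ K A u w) {s : ℝ} (hs : 0 ≤ s) :
    0 ≤ deriv G s := by
  rw [← h.deriv_zero]
  exact h.deriv_mono (mem_Ici.2 le_rfl) hs hs

theorem deriv_le (h : IsDecayingSolution G θ K A u w) {s : ℝ} (hs : 0 ≤ s) :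
    deriv G s ≤ K * s := by
  simpa [h.deriv_zero] using h.deriv_lip 0 s le_rfl hs

theorem u_le (h : IsDecayingSolution G θ K A u w) (x : ℝ) : u x ≤ A := by
  refine (h.decay x).trans (mul_le_of_le_one_right h.A_nonneg ?_)
  rw [div_le_one (by positivity)]
  nlinarith [sq_nonneg x]

theorem tendsto_u (h : IsDecayingSolution G θ K A u w) : Tendsto u (cocompact ℝ) (𝓝 0) := by
  have h1 : Tendsto (fun x : ℝ => A * (1 / (6 ^ 2 + x ^ 2))) (cocompact ℝ) (𝓝 0) := by
    have h2 : Tendsto (fun x : ℝ => (6 : ℝ) ^ 2 + x ^ 2) (cocompact ℝ) atTop := by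
      refine tendsto_atTop_add_const_left _ _ ?_
      refine ((tendsto_pow_atTop two_ne_zero).comp
        (tendsto_norm_cocompact_atTop (E := ℝ))).congr fun x => ?_
      simp
    simpa using (tendsto_const_nhds (x := (1 : ℝ)).div_atTop h2).const_mul A
  exact squeeze_zero (fun x => (h.u_pos x).le) h.decay h1

theorem tendsto_add_left_cocompact (c : ℝ) : Tendsto (fun s : ℝ => c + s) atTop (cocompact ℝ) :=
  (tendsto_atTop_add_const_left _ c tendsto_id).mono_right atTop_le_cocompact

theorem tendsto_sub_left_cocompact (c : ℝ) : Tendsto (fun s : ℝ => c - s) atTop (cocompact ℝ) := by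
  refine Tendsto.mono_right ?_ atBot_le_cocompact
  simp only [sub_eq_add_neg]
  exact tendsto_atBot_add_const_left _ c tendsto_neg_atTop_atBot

theorem reflected_u (h : IsDecayingSolution G θ K A u w) (c a : ℝ) :
    ∃ L, HasHalfLaplacianAt (fun s => u (c - s) - u (c + s)) L a ∧
      TailIntegrableAt (fun s => u (c - s) - u (c + s)) a ∧
      L + (u (c - a) - u (c + a)) =
        θ * (w (c - a) * deriv G (u (c - a)) - w (c + a) * deriv G (u (c + a))) := by
  obtain ⟨L₁, h₁, e₁⟩ := h.sol.eq_u (c + a)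
  obtain ⟨L₂, h₂, e₂⟩ := h.sol.eq_u (c - a)
  obtain ⟨h3, h4⟩ := h₁.reflection_sub h₂ (h.sol.u_mem.tailIntegrableAt _)
    (h.sol.u_mem.tailIntegrableAt _)
  refine ⟨L₂ - L₁, h3, h4, ?_⟩
  linarith

theorem superharmonic_w (h : IsDecayingSolution G θ K A u w) (hG0 : G 0 = 0) (x : ℝ) :
    ∃ L, 0 ≤ L ∧ HasHalfLaplacianAt w L x := by
  refine ⟨_, mul_nonneg Real.pi_pos.le ?_, h.sol.eq_w x⟩
  have := (sub_nonneg_of_deriv_monotoneOn h.differentiable h.deriv_zero h.deriv_mono le_rfl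
    (h.u_pos x).le).1
  rwa [hG0, sub_zero] at this

/-- A lower bound for the reflected difference of `u` controls that of `w`. -/
theorem exists_reflected_w_ge (h : IsDecayingSolution G θ K A u w) (hG0 : G 0 = 0) (Λ : ℝ) :
    ∃ C, 0 ≤ C ∧ ∀ c, Λ ≤ c → ∀ N, 0 ≤ N → (∀ s, 0 < s → -N ≤ u (c - s) - u (c + s)) →
      ∀ s, 0 < s → -(C * N) ≤ w (c - s) - w (c + s) := by
  have hK := h.K_nonneg
  have hA := h.A_nonneg
  set C : ℝ := Real.pi ^ 2 / 2 * (K * A * (1 + |Λ|)) with hC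
  have hC0 : 0 ≤ C := by positivity
  refine ⟨C, hC0, fun c hc N hN hU s₀ hs₀ => ?_⟩
  by_contra hcon
  rw [not_le] at hcon
  set W : ℝ → ℝ := fun s => w (c - s) - w (c + s) with hW
  have hwc := h.continuous_w
  have hWc : Continuous W := by fun_prop
  have hodd : ∀ s, W (-s) = -W s := fun s => by
    simp only [hW, sub_neg_eq_add, ← sub_eq_add_neg, neg_sub]
  have hW0 : W s₀ < -(C * N) := hcon
  -- Small enough that W(s₀) + κs₀ stays below -CN, yet positive, so that the sublinear bound on w
  -- makes W + κs ≥ 0 for large s.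
  set κ : ℝ := (-(C * N) - W s₀) / (2 * s₀) with hκ
  have hκ0 : 0 < κ := div_pos (by linarith) (by positivity)
  have hCN : 0 ≤ C * N := mul_nonneg hC0 hN
  have hV₀ : W s₀ + κ * s₀ < -(C * N) := by
    have : κ * s₀ = (-(C * N) - W s₀) / 2 := by
      rw [hκ]; field_simp
    rw [this]
    linarith
  obtain ⟨R, hR⟩ := exists_neg_mul_abs_le_of_superharmonic hwc h.sol.w_mem
    (h.superharmonic_w hG0) (half_pos hκ0)
  obtain ⟨a, ha, hale, hmin⟩ := exists_isMin_of_neg (f := fun s => W s + κ * s) (by fun_prop)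
    (by simp [hW]) hs₀ (by linarith) (by
      filter_upwards [(h.w_lim.comp (tendsto_add_left_cocompact c)).eventually_le_atBot 0,
        (tendsto_norm_cocompact_atTop.comp (tendsto_sub_left_cocompact c)).eventually_ge_atTop R,
        eventually_ge_atTop |c|] with s h1 h2 h3
      simp only [Function.comp_apply, Real.norm_eq_abs] at h1 h2
      have h4 := hR _ h2
      have h5 : |c - s| ≤ 2 * s := by
        rw [abs_le]
        constructor <;> linarith [le_abs_self c, neg_abs_le c]
      have h6 : κ / 2 * |c - s| ≤ κ / 2 * (2 * s) := by gcongr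
      have h7 : 0 ≤ W s + κ * s := by
        simp only [hW]
        linarith
      linarith)
  obtain ⟨hL, ht⟩ := (h.sol.eq_w (c + a)).reflection_sub (h.sol.eq_w (c - a))
    (h.sol.w_mem.tailIntegrableAt _) (h.sol.w_mem.tailIntegrableAt _)
  have hle := hL.le_two_mul_div_of_odd ht hWc hodd ha hmin
  change _ ≤ 2 * (W a + κ * a) / a at hle
  set V := W a + κ * a with hV
  have hVneg : V < -(C * N) := lt_of_le_of_lt hale hV₀
  set g := deriv G (u (c + a)) with hg
  have hg0 : 0 ≤ g := h.deriv_nonneg (h.u_pos _).le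
  have hGd : -(g * N) ≤ G (u (c - a)) - G (u (c + a)) := by
    rcases le_total (u (c + a)) (u (c - a)) with hu | hu
    · have := (sub_nonneg_of_deriv_monotoneOn h.differentiable h.deriv_zero h.deriv_mono
        (h.u_pos _).le hu).1
      have := mul_nonneg hg0 hN
      linarith
    · have h1 := (sub_nonneg_of_deriv_monotoneOn h.differentiable h.deriv_zero h.deriv_mono
        (h.u_pos _).le hu).2
      have h2 : g * (u (c + a) - u (c - a)) ≤ g * N := by
        gcongr
        linarith [hU a ha]
      linarith
  -- Quadratic decay pays for a: g = O(1/(36+(c+a)²)) and a ≤ |c+a| + |Λ|. This makes `C`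
  -- independent of c.
  have hga : a * g ≤ K * A * (1 + |Λ|) := by
    have h1 : g ≤ K * (A * (1 / (6 ^ 2 + (c + a) ^ 2))) :=
      (h.deriv_le (h.u_pos _).le).trans (mul_le_mul_of_nonneg_left (h.decay _) hK)
    have h2 : a ≤ (1 + |Λ|) * (6 ^ 2 + (c + a) ^ 2) := by
      have h3 : a ≤ |c + a| + |Λ| := by linarith [le_abs_self (c + a), neg_abs_le Λ]
      have h4 : |c + a| ≤ 6 ^ 2 + (c + a) ^ 2 := by
        rw [← sq_abs (c + a)]
        nlinarith [sq_nonneg (|c + a| - 1)]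
      nlinarith [mul_nonneg (abs_nonneg Λ) (sq_nonneg (c + a)), abs_nonneg Λ]
    calc a * g ≤ ((1 + |Λ|) * (6 ^ 2 + (c + a) ^ 2)) * (K * (A * (1 / (6 ^ 2 + (c + a) ^ 2)))) := by
          gcongr
      _ = K * A * (1 + |Λ|) := by
          field_simp
  have h1 : Real.pi ^ 2 * (-(g * N)) ≤ 2 * V / a := by
    refine le_trans ?_ hle
    have : Real.pi * (Real.pi * G (u (c - a)) - Real.pi * G (u (c + a))) =
      Real.pi ^ 2 * (G (u (c - a)) - G (u (c + a))) := by ring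
    rw [this]
    gcongr
  rw [le_div_iff₀ ha] at h1
  have h2 : Real.pi ^ 2 / 2 * (a * g) * N ≤ C * N := by
    rw [hC]
    gcongr
  linarith

/-- If the reflected difference is negative somewhere, it is negative somewhere in a fixed compact
region away from the reflection point. -/
theorem exists_reflected_neg_near (h : IsDecayingSolution G θ K A u w) (hG0 : G 0 = 0) (Λ : ℝ) :
    ∃ R δ : ℝ, 0 < δ ∧ ∀ c, Λ ≤ c → (∃ s, 0 < s ∧ u (c - s) - u (c + s) < 0) →
      ∃ s, δ ≤ s ∧ c + s ≤ R ∧ u (c - s) - u (c + s) < 0 := by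
  have hK := h.K_nonneg
  have hA := h.A_nonneg
  have hθ := h.θ_pos
  have huc := h.continuous_u
  obtain ⟨C, hC0, hC⟩ := h.exists_reflected_w_ge hG0 Λ
  obtain ⟨x₁, hx₁⟩ := h.continuous_w.exists_forall_ge h.w_lim
  set M := max (w x₁) 0 with hM
  have hM0 : 0 ≤ M := le_max_right _ _
  have hwM : ∀ x, max (w x) 0 ≤ M := fun x => max_le_max_right _ (hx₁ x)
  set P := θ * M * K + θ * C * K * A with hP
  have hP0 : 0 ≤ P := by positivity
  have hev : ∀ᶠ x in atTop, w x ≤ 0 ∧ θ * C * K * u x < 1 := by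
    refine ((h.w_lim.mono_left atTop_le_cocompact).eventually_le_atBot 0).and ?_
    have := (h.tendsto_u.mono_left atTop_le_cocompact).const_mul (θ * C * K)
    rw [mul_zero] at this
    exact this.eventually (gt_mem_nhds one_pos)
  obtain ⟨R, hR⟩ := eventually_atTop.1 hev
  -- The inequality `hmain` below gives 2/(πa) ≤ P, and π ≤ 4 then excludes a < 1/(2(P+1)). Beyond
  -- `R`, its right side is below 1.
  refine ⟨R, 1 / (2 * (P + 1)), by positivity, ?_⟩
  rintro c hc ⟨s₀, hs₀, hneg⟩
  set U : ℝ → ℝ := fun s => u (c - s) - u (c + s) with hU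
  have hUc : Continuous U := by fun_prop
  have hodd : ∀ s, U (-s) = -U s := fun s => by
    simp only [hU, sub_neg_eq_add, ← sub_eq_add_neg, neg_sub]
  have hUlim : Tendsto U atTop (𝓝 0) := by
    simpa using (h.tendsto_u.comp (tendsto_sub_left_cocompact c)).sub
      (h.tendsto_u.comp (tendsto_add_left_cocompact c))
  obtain ⟨a, ha, hale, hmin⟩ := exists_isMin_of_neg hUc (by simp [hU]) hs₀ hneg
    (hUlim.eventually (le_mem_nhds hneg))
  obtain ⟨L, hL, ht, hLeq⟩ := h.reflected_u c a
  have hle := hL.le_two_mul_div_of_odd ht hUc hodd ha (κ := 0)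
    fun s hs => by simpa only [zero_mul, add_zero] using hmin s hs
  rw [zero_mul, add_zero] at hle
  set N := -U a with hN
  have hN0 : 0 < N := by rw [hN]; linarith
  have hUa : u (c - a) - u (c + a) = -N := by rw [hN, neg_neg]
  have hWa := hC c hc N hN0.le (fun s hs => by rw [hN, neg_neg]; exact hmin s hs) a ha
  have hlt : u (c - a) ≤ u (c + a) := by linarith
  have hd0 : deriv G (u (c - a)) ≤ deriv G (u (c + a)) :=
    h.deriv_mono (h.u_pos _).le (h.u_pos _).le hlt
  have hd1 := h.deriv_lip _ _ (h.u_pos (c - a)).le hlt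
  have hg0 := h.deriv_nonneg (h.u_pos (c - a)).le
  have hg1 := hd0.trans (h.deriv_le (h.u_pos (c + a)).le)
  set m := max (w (c + a)) 0 with hm
  have hm0 : 0 ≤ m := le_max_right _ _
  -- The difference splits as W(a)g(u(c-a)) - w(c+a)(g(u(c+a)) - g(u(c-a))). The last bracket is
  -- non-negative, so only the positive part m of w(c+a) matters.
  have hRHS : -(m * (K * N) + C * N * (K * u (c + a))) ≤
      w (c - a) * deriv G (u (c - a)) - w (c + a) * deriv G (u (c + a)) := by
    have h1 : w (c + a) * (deriv G (u (c + a)) - deriv G (u (c - a))) ≤ m * (K * N) := by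
      calc w (c + a) * (deriv G (u (c + a)) - deriv G (u (c - a)))
          ≤ m * (deriv G (u (c + a)) - deriv G (u (c - a))) :=
            mul_le_mul_of_nonneg_right (le_max_left _ _) (by linarith)
        _ ≤ m * (K * N) := by
            refine mul_le_mul_of_nonneg_left (hd1.trans (le_of_eq ?_)) hm0
            rw [show u (c + a) - u (c - a) = N by linarith]
    have h2 : -(C * N * (K * u (c + a))) ≤ (w (c - a) - w (c + a)) * deriv G (u (c - a)) := by
      have h3 : C * N * deriv G (u (c - a)) ≤ C * N * (K * u (c + a)) :=
        mul_le_mul_of_nonneg_left hg1 (mul_nonneg hC0 hN0.le)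
      have h4 := mul_le_mul_of_nonneg_right hWa hg0
      linarith
    linarith
  have hmain : 1 + 2 / (Real.pi * a) ≤ θ * m * K + θ * C * K * u (c + a) := by
    have h1 := mul_le_mul_of_nonneg_left hRHS hθ.le
    rw [← hLeq, hUa] at h1
    have h2 : L ≤ -(2 / (Real.pi * a) * N) := by
      have h3 : Real.pi * -(2 / (Real.pi * a) * N) = 2 * U a / a := by
        rw [hN]
        field_simp
      refine le_of_mul_le_mul_left ?_ Real.pi_pos
      rw [h3]
      exact hle
    have h4 : (1 + 2 / (Real.pi * a)) * N ≤ (θ * m * K + θ * C * K * u (c + a)) * N := by linarith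
    exact le_of_mul_le_mul_right h4 hN0
  have hpos : 0 < 2 / (Real.pi * a) := by have := Real.pi_pos; positivity
  refine ⟨a, ?_, ?_, by linarith⟩
  · by_contra hcon
    rw [not_le, lt_div_iff₀ (by positivity)] at hcon
    have h1 : θ * m * K + θ * C * K * u (c + a) ≤ P := by
      rw [hP]
      gcongr
      · exact hwM _
      · exact h.u_le _
    have h2 : 2 / (Real.pi * a) ≤ P := by linarith
    have hpa : 0 < Real.pi * a := mul_pos Real.pi_pos ha
    rw [div_le_iff₀ hpa] at h2
    have h3 : Real.pi * a ≤ 4 * a := by nlinarith [Real.pi_le_four]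
    nlinarith
  · by_contra hcon
    rw [not_le] at hcon
    obtain ⟨h1, h2⟩ := hR _ hcon.le
    have h3 : m = 0 := max_eq_right h1
    rw [h3, mul_zero, zero_mul, zero_add] at hmain
    linarith

/-- Strong maximum principle for the reflected difference. -/
theorem reflected_eq_zero (h : IsDecayingSolution G θ K A u w) (hG0 : G 0 = 0) {c a : ℝ}
    (hnn : ∀ s, 0 < s → 0 ≤ u (c - s) - u (c + s)) (ha : 0 < a) (hz : u (c - a) - u (c + a) = 0)
    (x : ℝ) : u (c + x) = u (c - x) := by
  have huc := h.continuous_u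
  have hpos : ∀ b, 0 < b → u (c - b) - u (c + b) = 0 := by
    intro b hb
    by_contra hne
    have hVb : 0 < u (c - b) - u (c + b) := lt_of_le_of_ne (hnn b hb) (Ne.symm hne)
    obtain ⟨C, -, hC⟩ := h.exists_reflected_w_ge hG0 c
    -- N = 0 turns U ≥ 0 into W ≥ 0, so the equation at a gives L ≥ 0, against the strict sign.
    have hW := hC c le_rfl 0 le_rfl (by simpa using hnn) a ha
    obtain ⟨L, hL, ht, hLeq⟩ := h.reflected_u c a
    have hLneg := hL.neg_of_odd ht (by fun_prop)
      (fun s => by simp only [sub_neg_eq_add, ← sub_eq_add_neg, neg_sub]) ha hz hnn hb hVb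
    have hueq : u (c - a) = u (c + a) := by linarith
    rw [hz, add_zero, hueq, ← sub_mul] at hLeq
    have := mul_nonneg h.θ_pos.le (mul_nonneg (by linarith : 0 ≤ w (c - a) - w (c + a))
      (h.deriv_nonneg (h.u_pos (c + a)).le))
    linarith
  rcases lt_trichotomy x 0 with hx | rfl | hx
  · have := hpos (-x) (by linarith)
    rw [sub_neg_eq_add, ← sub_eq_add_neg] at this
    linarith
  · simp
  · have := hpos x hx
    linarith

/-! ### The moving plane argument -/

theorem exists_symmetric_strictAntiOn (h : IsDecayingSolution G θ K A u w) (hG0 : G 0 = 0) :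
    ∃ x₀ : ℝ, (∀ x : ℝ, u (x₀ + x) = u (x₀ - x)) ∧
      StrictAntiOn (fun r : ℝ => u (x₀ + r)) (Ici 0) := by
  have huc := h.continuous_u
  set B : Set ℝ := {c | ∃ s, 0 < s ∧ u (c - s) - u (c + s) < 0} with hB
  have hBne : B.Nonempty := by
    have hev := (h.tendsto_u.mono_left atBot_le_cocompact).eventually (gt_mem_nhds (h.u_pos 0))
    obtain ⟨y, hy, hy0⟩ := (hev.and (eventually_lt_atBot 0)).exists
    -- Reflection about y/2 exchanges y and 0, and u(y) < u(0).
    refine ⟨y / 2, -(y / 2), by linarith, ?_⟩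
    rw [sub_neg_eq_add, add_halves, add_neg_cancel]
    linarith
  have hBbdd : BddAbove B := by
    obtain ⟨R, δ, hδ, hR⟩ := h.exists_reflected_neg_near hG0 0
    refine ⟨max 0 R, fun c hc => ?_⟩
    by_contra hcon
    rw [not_le, max_lt_iff] at hcon
    obtain ⟨s, hs, hsR, -⟩ := hR c hcon.1.le hc
    linarith
  set c₀ := sSup B with hc₀
  have habove : ∀ c, c₀ < c → ∀ s, 0 < s → 0 ≤ u (c - s) - u (c + s) := by
    intro c hc s hs
    by_contra hcon
    exact absurd (le_csSup hBbdd ⟨s, hs, not_le.1 hcon⟩) (not_le.2 hc)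
  have hat : ∀ s, 0 < s → 0 ≤ u (c₀ - s) - u (c₀ + s) := by
    intro s hs
    have hlim : Tendsto (fun c => u (c - s) - u (c + s)) (𝓝[>] c₀) (𝓝 (u (c₀ - s) - u (c₀ + s))) :=
      (Continuous.tendsto (by fun_prop) c₀).mono_left nhdsWithin_le_nhds
    refine ge_of_tendsto hlim ?_
    filter_upwards [self_mem_nhdsWithin] with c hc using habove c hc s hs
  have hsymm : ∀ x, u (c₀ + x) = u (c₀ - x) := by
    by_cases hz : ∃ a, 0 < a ∧ u (c₀ - a) - u (c₀ + a) = 0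
    · obtain ⟨a, ha, hza⟩ := hz
      exact h.reflected_eq_zero hG0 hat ha hza
    exfalso
    push Not at hz
    obtain ⟨R, δ, hδ, hR⟩ := h.exists_reflected_neg_near hG0 (c₀ - 1)
    -- For c > c₀ - 1, c + s ≤ R gives s ≤ R - c₀ + 1, so this compact interval contains every
    -- location where negativity must appear.
    have hev : ∀ᶠ c in 𝓝 c₀, ∀ s ∈ Icc δ (R - c₀ + 1), 0 < u (c - s) - u (c + s) := by
      refine isCompact_Icc.eventually_forall_of_forall_eventually fun s hs => ?_
      have hs0 : 0 < s := hδ.trans_le hs.1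
      have hpos : 0 < u (c₀ - s) - u (c₀ + s) := lt_of_le_of_ne (hat s hs0) (hz s hs0).symm
      have hcont : Continuous fun z : ℝ × ℝ => u (z.1 - z.2) - u (z.1 + z.2) := by fun_prop
      exact hcont.continuousAt.eventually (lt_mem_nhds hpos)
    obtain ⟨η, hη, hball⟩ := Metric.eventually_nhds_iff.1 hev
    obtain ⟨c, hcB, hc⟩ := exists_lt_of_lt_csSup hBne (show c₀ - min η 1 < sSup B by
      rw [← hc₀]; linarith [lt_min hη one_pos])
    have hcle : c ≤ c₀ := le_csSup hBbdd hcB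
    have h1 := min_le_left η 1
    have h2 := min_le_right η 1
    obtain ⟨s, hs, hsR, hsneg⟩ := hR c (by linarith) hcB
    have := hball (y := c) (by rw [Real.dist_eq, abs_lt]; constructor <;> linarith) s
      ⟨hs, by linarith⟩
    linarith
  have hstrict : ∀ c, c₀ < c → ∀ s, 0 < s → 0 < u (c - s) - u (c + s) := by
    intro c hc s hs
    refine lt_of_le_of_ne (habove c hc s hs) fun hz => ?_
    have hsymm' := h.reflected_eq_zero hG0 (habove c hc) hs hz.symm
    -- Reflections about c₀ and c compose to translation by 2(c - c₀).
    have hper : Function.Periodic u (2 * (c - c₀)) := by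
      intro x
      have h1 := hsymm' (x + c - 2 * c₀)
      have h2 := hsymm (c₀ - x)
      rw [show c + (x + c - 2 * c₀) = x + 2 * (c - c₀) by ring,
        show c - (x + c - 2 * c₀) = c₀ + (c₀ - x) by ring] at h1
      rw [show c₀ - (c₀ - x) = x by ring] at h2
      rw [h1, h2]
    have hlim : Tendsto (fun n : ℕ => (n : ℝ) * (2 * (c - c₀))) atTop (cocompact ℝ) :=
      (tendsto_natCast_atTop_atTop.atTop_mul_const (by linarith)).mono_right atTop_le_cocompact
    have hconst : Tendsto (fun _ : ℕ => u 0) atTop (𝓝 0) :=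
      (h.tendsto_u.comp hlim).congr fun n => hper.nat_mul_eq n
    exact (h.u_pos 0).ne' (tendsto_nhds_unique tendsto_const_nhds hconst)
  refine ⟨c₀, hsymm, fun r hr t _ hrt => ?_⟩
  -- c₀+r and c₀+t are mirror images about their midpoint, which lies to the right of c₀.
  have := hstrict (c₀ + (r + t) / 2) (by linarith [mem_Ici.1 hr]) ((t - r) / 2) (by linarith)
  rw [show c₀ + (r + t) / 2 - (t - r) / 2 = c₀ + r by ring,
    show c₀ + (r + t) / 2 + (t - r) / 2 = c₀ + t by ring] at this
  simp only
  linarith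

end IsDecayingSolution

/-! ### From the hypotheses to a decaying solution -/

/-- The essential bound holds on a dense set, and continuity makes that set closed. -/
theorem exists_forall_le_of_memLp_top {u : ℝ → ℝ} (hu : Continuous u) (h : MemLp u ⊤ volume) :
    ∃ M, 0 ≤ M ∧ ∀ x, u x ≤ M := by
  refine ⟨(eLpNormEssSup u volume).toReal, ENNReal.toReal_nonneg, fun x => ?_⟩
  have hfin : eLpNormEssSup u volume ≠ ⊤ := by
    have := h.2
    rw [eLpNorm_exponent_top] at this
    exact this.ne
  have hae : ∀ᵐ x, u x ≤ (eLpNormEssSup u volume).toReal := by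
    filter_upwards [ae_le_eLpNormEssSup (f := u) (μ := volume)] with x hx
    have h1 := ENNReal.toReal_mono hfin hx
    rw [toReal_enorm] at h1
    exact (le_abs_self _).trans h1
  have hd := Measure.dense_of_ae hae
  have hcl : IsClosed {x | u x ≤ (eLpNormEssSup u volume).toReal} := isClosed_le hu continuous_const
  have hx : x ∈ closure {x | u x ≤ (eLpNormEssSup u volume).toReal} := hd x
  rwa [hcl.closure_eq] at hx

theorem theorem1p6 (G : ℝ → ℝ) (hG : ContDiff ℝ 1 G) (hG0 : G 0 = 0) (hg0 : deriv G 0 = 0)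
    (hgmono : MonotoneOn (deriv G) (Set.Ici 0))
    (hglip : ∃ K : NNReal, LipschitzOnWith K (deriv G) (Set.Ici 0))
    (θ : ℝ) (hθ : 0 < θ) (u w : ℝ → ℝ) (hsol : IsClassicalSolution G θ u w)
    (hupos : ∀ x : ℝ, 0 < u x) (hubdd : MeasureTheory.MemLp u ⊤ MeasureTheory.volume)
    (hw : Filter.Tendsto w (Filter.cocompact ℝ) Filter.atBot) :
    ∃ x₀ : ℝ, (∀ x : ℝ, u (x₀ + x) = u (x₀ - x)) ∧
      StrictAntiOn (fun r : ℝ => u (x₀ + r)) (Set.Ici 0) := by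
  obtain ⟨K, hK⟩ := hglip
  have huc : Continuous u := hsol.u_c11.1.continuous
  obtain ⟨M, hM0, hM⟩ := exists_forall_le_of_memLp_top huc hubdd
  obtain ⟨R, hR⟩ : ∃ R : ℝ, ∀ x, R < |x| → w x ≤ 0 := by
    have hev := hw.eventually_le_atBot 0
    rw [cocompact_eq_atBot_atTop, eventually_sup] at hev
    obtain ⟨a, ha⟩ := eventually_atBot.1 hev.1
    obtain ⟨b, hb⟩ := eventually_atTop.1 hev.2
    refine ⟨max (-a) b, fun x hx => ?_⟩
    rw [max_lt_iff] at hx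
    rcases abs_cases x with ⟨h1, -⟩ | ⟨h1, -⟩
    · exact hb x (by linarith)
    · exact ha x (by linarith)
  obtain ⟨A, hA0, hA⟩ := exists_quadratic_decay huc hsol.u_mem.tailIntegrableAt (R := R) hM0 hM
    fun x hx => by
      obtain ⟨L, hL, hLeq⟩ := hsol.eq_u x
      refine ⟨L, hL, ?_⟩
      rw [hLeq]
      refine mul_nonpos_of_nonpos_of_nonneg (mul_nonpos_of_nonneg_of_nonpos hθ.le (hR x hx)) ?_
      rw [← hg0]
      exact hgmono (mem_Ici.2 le_rfl) (hupos x).le (hupos x).le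
  have hdec : IsDecayingSolution G θ K A u w :=
    { sol := hsol
      differentiable := hG.differentiable one_ne_zero
      deriv_zero := hg0
      deriv_mono := hgmono
      K_nonneg := K.coe_nonneg
      deriv_lip := fun a b ha hab => by
        have := hK.dist_le_mul b (mem_Ici.2 (ha.trans hab)) a (mem_Ici.2 ha)
        rw [Real.dist_eq, Real.dist_eq, abs_of_nonneg (sub_nonneg.2 hab)] at this
        exact (le_abs_self _).trans this
      θ_pos := hθ
      u_pos := hupos
      A_nonneg := hA0
      decay := hA
      w_lim := hw }
  exact hdec.exists_symmetric_strictAntiOn hG0
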